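/- Let $n\ge 1$. Let $\mathfrak h_n=\mathbb C^{2n}\oplus\mathbb C z$ be the Heisenberg Lie algebra with $[e_i,e_{n+i}]=z$ for $1\le i\le n$, all other brackets of basis vectors (up to antisymmetry) being zero. Let $\mathfrak{so}_n$ be the Lie algebra of complex skew-symmetric $n\times n$ matrices, and let $\mathfrak s_n=(\mathfrak{sl}_2\oplus\mathfrak{so}_n)\ltimes\mathfrak h_n$ be the complex Schrödinger Lie algebra, where $\begin{pmatrix}a&b\\c&-a\end{pmatrix}\in\mathfrak{sl}_2$ acts on $\mathbb C^{2n}$ as $\begin{pmatrix}aI_n&bI_n\\cI_n&-aI_n\end{pmatrix}$, $A\in\mathfrak{so}_n$ acts as $\begin{pmatrix}A&0\\0&A\end{pmatrix}$, and $[z,\mathfrak s_n]=0$. Let $h=\mathrm{diag}(1,-1)\in\mathfrak{sl}_2\subset\mathfrak s_n$. A module over $\mathfrak s_n$ or $\mathfrak{sl}_2$ is a weight module if it is the direct sum of its weight spaces $M_\lambda=\{v\in M: hv=\lambda v\}$, $\lambda\in\mathbb C$. A weight $\mathfrak s_n$-module is a Harish-Chandra module if all its weight spaces are finite-dimensional.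 Theorem. Let $M$ be an irreducible Harish-Chandra $\mathfrak s_n$-module on which $z$ acts as zero. Then $\mathfrak h_nM=0$, and $M$ is irreducible as an $\mathfrak{so}_n\oplus\mathfrak{sl}_2$-module. Moreover, there are a finite-dimensional irreducible $\mathfrak{so}_n$-module $V$ and an irreducible weight $\mathfrak{sl}_2$-module $L$ such that $M\cong V\otimes L$ as $\mathfrak s_n$-modules, where $(B,A)\in\mathfrak{sl}_2\oplus\mathfrak{so}_n$ acts on $V\otimes L$ by $v\otimes l\mapsto Av\otimes l+v\otimes Bl$ and $\mathfrak h_n$ acts on $V\otimes L$ by zero. -/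

import Mathlib

universe u

open scoped TensorProduct Matrix

noncomputable section

namespace Schr

/-- The complex Lie algebra `sl₂` of traceless `2 × 2` matrices. -/
abbrev SL2 : Type := LieAlgebra.SpecialLinear.sl (Fin 2) ℂ

/-- The complex Lie algebra `so_n` of skew-symmetric `n × n` matrices. -/
abbrev SO (n : ℕ) : Type := LieAlgebra.Orthogonal.so (Fin n) ℂ

/-- The Heisenberg Lie algebra `ℂ^{2n} ⊕ ℂ z`. An element is `∑ xᵢ eᵢ + ∑ yᵢ e_{n+i} + c z`. -/
@[ext] structure Heis (n : ℕ) where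
  /-- coordinates along `e₁, …, e_n` -/
  x : Fin n → ℂ
  /-- coordinates along `e_{n+1}, …, e_{2n}` -/
  y : Fin n → ℂ
  /-- coordinate along the central element `z` -/
  c : ℂ

namespace Heis

variable {n : ℕ}

/-- The underlying set of the Heisenberg algebra is a product. -/
def toProd : Heis n ≃ (Fin n → ℂ) × (Fin n → ℂ) × ℂ where
  toFun u := (u.x, u.y, u.c)
  invFun p := ⟨p.1, p.2.1, p.2.2⟩
  left_inv _ := rfl
  right_inv _ := rfl

instance : AddCommGroup (Heis n) := toProd.addCommGroup

instance : Module ℂ (Heis n) := toProd.module ℂ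

@[simp] lemma zero_x : (0 : Heis n).x = 0 := rfl
@[simp] lemma zero_y : (0 : Heis n).y = 0 := rfl
@[simp] lemma zero_c : (0 : Heis n).c = 0 := rfl
@[simp] lemma add_x (u v : Heis n) : (u + v).x = u.x + v.x := rfl
@[simp] lemma add_y (u v : Heis n) : (u + v).y = u.y + v.y := rfl
@[simp] lemma add_c (u v : Heis n) : (u + v).c = u.c + v.c := rfl
@[simp] lemma neg_x (u : Heis n) : (-u).x = -u.x := rfl
@[simp] lemma neg_y (u : Heis n) : (-u).y = -u.y := rfl
@[simp] lemma neg_c (u : Heis n) : (-u).c = -u.c := rfl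
@[simp] lemma sub_x (u v : Heis n) : (u - v).x = u.x - v.x := rfl
@[simp] lemma sub_y (u v : Heis n) : (u - v).y = u.y - v.y := rfl
@[simp] lemma sub_c (u v : Heis n) : (u - v).c = u.c - v.c := rfl
@[simp] lemma smul_x (t : ℂ) (u : Heis n) : (t • u).x = t • u.x := rfl
@[simp] lemma smul_y (t : ℂ) (u : Heis n) : (t • u).y = t • u.y := rfl
@[simp] lemma smul_c (t : ℂ) (u : Heis n) : (t • u).c = t * u.c := rfl

/-- The bracket with `[eᵢ, e_{n+i}] = z` and all other brackets of basis vectors zero. -/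
instance : Bracket (Heis n) (Heis n) where
  bracket u v := ⟨0, 0, u.x ⬝ᵥ v.y - u.y ⬝ᵥ v.x⟩

@[simp] lemma lie_x (u v : Heis n) : ⁅u, v⁆.x = 0 := rfl
@[simp] lemma lie_y (u v : Heis n) : ⁅u, v⁆.y = 0 := rfl
@[simp] lemma lie_c (u v : Heis n) : ⁅u, v⁆.c = u.x ⬝ᵥ v.y - u.y ⬝ᵥ v.x := rfl

instance : LieRing (Heis n) where
  add_lie u v w := by ext <;> simp [add_dotProduct]; ring
  lie_add u v w := by ext <;> simp [dotProduct_add]; ring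
  lie_self u := by ext <;> simp [dotProduct_comm]
  leibniz_lie u v w := by ext <;> simp

instance : LieAlgebra ℂ (Heis n) where
  lie_smul t u v := by ext <;> simp [mul_sub]

end Heis

/-- The linear action of a pair of matrices on the Heisenberg algebra: `(B, A)` acts on `ℂ^{2n}` as
the block matrix `[[B₀₀ I + A, B₀₁ I], [B₁₀ I, B₁₁ I + A]]`, and kills `z`. -/
def actFun {n : ℕ} (B : Matrix (Fin 2) (Fin 2) ℂ) (A : Matrix (Fin n) (Fin n) ℂ) :
    Heis n →ₗ[ℂ] Heis n where
  toFun u := ⟨B 0 0 • u.x + B 0 1 • u.y + A *ᵥ u.x, B 1 0 • u.x + B 1 1 • u.y + A *ᵥ u.y, 0⟩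
  map_add' u v := by ext <;> simp [Matrix.mulVec_add] <;> ring
  map_smul' t u := by ext <;> simp [Matrix.mulVec_smul] <;> ring

section actFun

variable {n : ℕ} (B B' : Matrix (Fin 2) (Fin 2) ℂ) (A A' : Matrix (Fin n) (Fin n) ℂ) (u v : Heis n)

@[simp] lemma actFun_x : (actFun B A u).x = B 0 0 • u.x + B 0 1 • u.y + A *ᵥ u.x := rfl
@[simp] lemma actFun_y : (actFun B A u).y = B 1 0 • u.x + B 1 1 • u.y + A *ᵥ u.y := rfl
@[simp] lemma actFun_c : (actFun B A u).c = 0 := rfl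

lemma actFun_add : actFun (B + B') (A + A') u = actFun B A u + actFun B' A' u := by
  ext <;> simp [Matrix.add_mulVec] <;> ring

lemma actFun_smul (t : ℂ) : actFun (t • B) (t • A) u = t • actFun B A u := by
  ext <;> simp [Matrix.smul_mulVec] <;> ring

lemma actFun_commutator : actFun (B * B' - B' * B) (A * A' - A' * A) u =
    actFun B A (actFun B' A' u) - actFun B' A' (actFun B A u) := by
  ext <;> simp [Matrix.sub_mulVec, Matrix.mul_apply, Fin.sum_univ_two, Matrix.mulVec_add,
    Matrix.mulVec_smul] <;> ring

lemma actFun_leibniz (hB : B.trace = 0) (hA : Aᵀ = -A) :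
    actFun B A ⁅u, v⁆ = ⁅u, actFun B A v⁆ - ⁅v, actFun B A u⁆ := by
  have htr : B 1 1 = - B 0 0 := by
    rw [Matrix.trace_fin_two] at hB
    linear_combination hB
  have hsk : ∀ p q : Fin n → ℂ, p ⬝ᵥ (A *ᵥ q) = - (q ⬝ᵥ (A *ᵥ p)) := fun p q => by
    rw [Matrix.dotProduct_mulVec, ← Matrix.mulVec_transpose, hA, Matrix.neg_mulVec,
      neg_dotProduct, dotProduct_comm]
  ext
  · simp
  · simp
  · simp only [actFun_c, Heis.lie_c, actFun_x, actFun_y, Heis.sub_c, dotProduct_add,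
      dotProduct_smul, htr, smul_eq_mul]
    rw [dotProduct_comm v.x u.y, dotProduct_comm v.y u.x, dotProduct_comm v.x u.x,
      dotProduct_comm v.y u.y, hsk v.x, hsk v.y]
    ring

end actFun

/-- The action of `sl₂ ⊕ so_n` on the Heisenberg algebra by derivations. -/
def act (n : ℕ) : SL2 × SO n →ₗ⁅ℂ⁆ LieDerivation ℂ (Heis n) (Heis n) where
  toFun g :=
    { actFun g.1.1 g.2.1 with
      leibniz' := fun u v => actFun_leibniz _ _ u v g.1.2
        ((LieAlgebra.Orthogonal.mem_so (Fin n) ℂ g.2.1).1 g.2.2) }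
  map_add' _ _ := LieDerivation.ext fun u => actFun_add _ _ _ _ u
  map_smul' t _ := LieDerivation.ext fun u => actFun_smul _ _ u t
  map_lie' := LieDerivation.ext fun u => actFun_commutator _ _ _ _ u

@[simp] lemma act_apply {n : ℕ} (g : SL2 × SO n) (u : Heis n) :
    act n g u = actFun g.1.1 g.2.1 u := rfl

/-- The Schrödinger Lie algebra `s_n = (sl₂ ⊕ so_n) ⋉ h_n`. -/
abbrev Schrodinger (n : ℕ) : Type :=
  LieAlgebra.SemiDirectSum (Heis n) (SL2 × SO n) (act n)

/-- The inclusion of the Heisenberg algebra into `s_n`. -/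
abbrev heis (n : ℕ) : Heis n →ₗ⁅ℂ⁆ Schrodinger n := LieAlgebra.SemiDirectSum.inl (act n)

/-- The inclusion of `sl₂ ⊕ so_n` into `s_n`. -/
abbrev levi (n : ℕ) : SL2 × SO n →ₗ⁅ℂ⁆ Schrodinger n := LieAlgebra.SemiDirectSum.inr (act n)

/-- The element `h = diag(1, -1)` of `sl₂`. -/
def hSL2 : SL2 := LieAlgebra.SpecialLinear.singleSubSingle (0 : Fin 2) 1 (1 : ℂ)

/-- The element `h` of `s_n`. -/
def hElt (n : ℕ) : Schrodinger n := levi n (hSL2, 0)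

/-- The central element `z` of `s_n`. -/
def zElt (n : ℕ) : Schrodinger n := heis n ⟨0, 0, 1⟩

section Weight

variable {𝔤 : Type*} [LieRing 𝔤] [LieAlgebra ℂ 𝔤] (H : 𝔤)
  (M : Type*) [AddCommGroup M] [Module ℂ M] [LieRingModule 𝔤 M] [LieModule ℂ 𝔤 M]

/-- The weight space `M_μ = {v | H v = μ v}` of the element `H`. -/
def wtSpace (μ : ℂ) : Submodule ℂ M := (LieModule.toEnd ℂ 𝔤 M H).eigenspace μ

lemma mem_wtSpace {μ : ℂ} {v : M} : v ∈ wtSpace H M μ ↔ ⁅H, v⁆ = μ • v :=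
  Module.End.mem_eigenspace_iff

/-- `M` is a weight module with respect to `H`: it is the direct sum of its weight spaces. -/
def IsWeightModule : Prop := DirectSum.IsInternal (fun μ : ℂ => wtSpace H M μ)

end Weight

/-- A Harish-Chandra `s_n`-module: a weight module (with respect to `h`) all of whose weight spaces
are finite dimensional. -/
def IsHarishChandra (n : ℕ) (M : Type*) [AddCommGroup M] [Module ℂ M]
    [LieRingModule (Schrodinger n) M] [LieModule ℂ (Schrodinger n) M] : Prop :=
  IsWeightModule (hElt n) M ∧ ∀ μ : ℂ, FiniteDimensional ℂ (wtSpace (hElt n) M μ)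

/-- The tensor product `V ⊗ L` of an `so_n`-module `V` and an `sl₂`-module `L`, as a module over
`s_n`: here `(B, A) ∈ sl₂ ⊕ so_n` acts by `v ⊗ l ↦ A v ⊗ l + v ⊗ B l`, and `h_n` acts by zero. -/
def OuterTensor (_n : ℕ) (V L : Type*) [AddCommGroup V] [Module ℂ V] [AddCommGroup L] [Module ℂ L] :
    Type _ := V ⊗[ℂ] L

namespace OuterTensor

variable {n : ℕ} {V L : Type*} [AddCommGroup V] [Module ℂ V] [AddCommGroup L] [Module ℂ L]

instance : AddCommGroup (OuterTensor n V L) := inferInstanceAs (AddCommGroup (V ⊗[ℂ] L))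

instance : Module ℂ (OuterTensor n V L) := inferInstanceAs (Module ℂ (V ⊗[ℂ] L))

variable [LieRingModule (SO n) V] [LieModule ℂ (SO n) V] [LieRingModule SL2 L] [LieModule ℂ SL2 L]

/-- The operator by which an element of `s_n` acts on `V ⊗ L`. -/
def op (s : Schrodinger n) : Module.End ℂ (V ⊗[ℂ] L) :=
  (LieModule.toEnd ℂ (SO n) V s.right.2).rTensor L + (LieModule.toEnd ℂ SL2 L s.right.1).lTensor V

lemma op_add (s s' : Schrodinger n) : (op (s + s') : Module.End ℂ (V ⊗[ℂ] L)) = op s + op s' := by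
  ext v l
  simp [op]
  abel

lemma op_smul (c : ℂ) (s : Schrodinger n) : (op (c • s) : Module.End ℂ (V ⊗[ℂ] L)) = c • op s := by
  ext v l
  simp [op, TensorProduct.smul_tmul']

lemma op_lie (s s' : Schrodinger n) :
    (op s * op s' : Module.End ℂ (V ⊗[ℂ] L)) = op ⁅s, s'⁆ + op s' * op s := by
  ext v l
  simp [op, TensorProduct.sub_tmul, TensorProduct.tmul_sub]
  abel

instance : LieRingModule (Schrodinger n) (OuterTensor n V L) where
  bracket s t := op s (show V ⊗[ℂ] L from t)
  add_lie s s' t := LinearMap.congr_fun (op_add s s') (show V ⊗[ℂ] L from t)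
  lie_add s _ _ := map_add (op s) _ _
  leibniz_lie s s' t := LinearMap.congr_fun (op_lie s s') (show V ⊗[ℂ] L from t)

instance : LieModule ℂ (Schrodinger n) (OuterTensor n V L) where
  smul_lie c s t := LinearMap.congr_fun (op_smul c s) (show V ⊗[ℂ] L from t)
  lie_smul c s _ := map_smul (op s) c _

lemma lie_tmul (s : Schrodinger n) (v : V) (l : L) :
    (⁅s, (show OuterTensor n V L from v ⊗ₜ[ℂ] l)⁆ : OuterTensor n V L) =
      (show OuterTensor n V L from ⁅s.right.2, v⁆ ⊗ₜ[ℂ] l + v ⊗ₜ[ℂ] ⁅s.right.1, l⁆) := rfl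

end OuterTensor

end Schr

end

noncomputable section

namespace Schr

open Module (End)

/-! ### The abelian ideal acts by zero: operator formulation -/

section OpSys

variable {M ι : Type*} [AddCommGroup M] [Module ℂ M]

/-! Since `z` acts as zero, the operators X_i, Y_i of e_i, e_{n+i} commute. If the commutator of u
with every generator commutes with u, each generalized eigenspace of u is a submodule, hence zero or
M. This applies to u = X_i and to u = X_i Y_i.

X_i Y_i preserves weight, so it has an eigenvalue c on a finite-dimensional weight space, and X_i
Y_i - c is locally nilpotent on M. If c ≠ 0, then X_i and Y_i are injective; this bounds the
nilpotency degree uniformly along the weights μ + 2k, and repeated commutation with E turns the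
bound into X_i^{2d} v = 0, a contradiction (`maxGenEigenspace_XY_zero`). So c = 0, and X_i or Y_i is
locally nilpotent. If X_i is locally nilpotent while Y_i is injective, the weights μ + m stop at a
top weight, and the vectors F^k Y_j w with all X_l w = 0 span a submodule missing that weight. It
must be zero, which contradicts injectivity of Y_i (`not_nilpotent_and_injective`). By symmetry all
X_i, Y_i are locally nilpotent; they commute, so they have a nonzero common kernel, which is a
submodule and therefore M (`X_Y_eq_zero`).

Now M is irreducible over sl₂ ⊕ so_n. A weight space is a finite-dimensional so_n-module and
contains an irreducible V. With L = Hom_{so_n}(V, M), evaluation V ⊗ L → M is injective by Schur's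
lemma and surjective by irreducibility of M; the same two facts make L irreducible over sl₂. -/

lemma apply_mem_maxGenEigenspace_of_commutator {u G D : End ℂ M} {c : ℂ}
    (hD : ∀ v, u (G v) = G (u v) + D v) (hc : Commute u D) {v : M}
    (hv : v ∈ u.maxGenEigenspace c) : G v ∈ u.maxGenEigenspace c := by
  -- Induction on the nilpotency order of v: (u - c) G v = G (u - c) v + D v, where the first term
  -- has smaller order before G, and D preserves the eigenspace.
  have key : ∀ (k : ℕ) (v : M), ((u - c • 1) ^ k) v = 0 → G v ∈ u.maxGenEigenspace c := by
    intro k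
    induction k with
    | zero =>
      intro v hv
      have : v = 0 := by simpa using hv
      simp [this]
    | succ k ih =>
      intro v hv
      have h1 : D v ∈ u.maxGenEigenspace c :=
        End.mapsTo_maxGenEigenspace_of_comm hc c ((End.mem_maxGenEigenspace u c v).2 ⟨_, hv⟩)
      have h2 : G ((u - c • 1) v) ∈ u.maxGenEigenspace c := ih _ (by
        rwa [pow_succ, Module.End.mul_apply] at hv)
      have h3 : (u - c • 1) (G v) = G ((u - c • 1) v) + D v := by
        simp [hD]; abel
      obtain ⟨m, hm⟩ := (End.mem_maxGenEigenspace u c _).1 (h3 ▸ add_mem h2 h1)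
      exact (End.mem_maxGenEigenspace u c _).2 ⟨m + 1, by rwa [pow_succ, Module.End.mul_apply]⟩
  obtain ⟨k, hk⟩ := (End.mem_maxGenEigenspace u c v).1 hv
  exact key k v hk

/-- Operators on `M` satisfying the relations of `(sl₂ ⊕ so_n) ⋉ ℂ^{2n}`, acting irreducibly, with
`M` the sum of the eigenspaces of `H`, all of them finite dimensional. -/
structure OpSys (E F H : End ℂ M) (X Y : ι → End ℂ M) (S : Set (End ℂ M)) : Prop where
  EF : ∀ v, E (F v) = F (E v) + H v
  HE : ∀ v, H (E v) = E (H v) + (2 : ℂ) • E v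
  HF : ∀ v, H (F v) = F (H v) - (2 : ℂ) • F v
  HX : ∀ i v, H (X i v) = X i (H v) + X i v
  HY : ∀ i v, H (Y i v) = Y i (H v) - Y i v
  EX : ∀ i v, E (X i v) = X i (E v)
  EY : ∀ i v, E (Y i v) = Y i (E v) + X i v
  FX : ∀ i v, F (X i v) = X i (F v) + Y i v
  FY : ∀ i v, F (Y i v) = Y i (F v)
  XX : ∀ i j v, X i (X j v) = X j (X i v)
  XY : ∀ i j v, X i (Y j v) = Y j (X i v)
  YY : ∀ i j v, Y i (Y j v) = Y j (Y i v)
  AE : ∀ A ∈ S, ∀ v, A (E v) = E (A v)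
  AF : ∀ A ∈ S, ∀ v, A (F v) = F (A v)
  AX : ∀ A ∈ S, ∀ i, ∃ D ∈ Submodule.span ℂ (Set.range X), ∀ v, A (X i v) = X i (A v) + D v
  AY : ∀ A ∈ S, ∀ i, ∃ D ∈ Submodule.span ℂ (Set.range Y), ∀ v, A (Y i v) = Y i (A v) + D v
  irr : ∀ N : Submodule ℂ M, (∀ v ∈ N, E v ∈ N) → (∀ v ∈ N, F v ∈ N) →
    (∀ i, ∀ v ∈ N, X i v ∈ N) → (∀ i, ∀ v ∈ N, Y i v ∈ N) → (∀ A ∈ S, ∀ v ∈ N, A v ∈ N) →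
    N = ⊥ ∨ N = ⊤
  iSup : ⨆ μ, H.eigenspace μ = ⊤
  fin : ∀ μ, FiniteDimensional ℂ (H.eigenspace μ)
  ntriv : Nontrivial M

namespace OpSys

variable {E F H : End ℂ M} {X Y : ι → End ℂ M} {S : Set (End ℂ M)}

/-- The Weyl reflection of sl₂. Every result about the X i thereby yields one about the Y i. -/
lemma swap (h : OpSys E F H X Y S) : OpSys F E (-H) Y X S where
  EF v := by simp [h.EF]
  HE v := by simp [h.HF]; abel
  HF v := by simp [h.HE]; abel
  HX i v := by simp [h.HY]; abel
  HY i v := by simp [h.HX]; abel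
  EX := h.FY
  EY := h.FX
  FX := h.EY
  FY := h.EX
  XX := h.YY
  XY i j v := (h.XY j i v).symm
  YY := h.XX
  AE := h.AF
  AF := h.AE
  AX := h.AY
  AY := h.AX
  irr N h1 h2 h3 h4 h5 := h.irr N h2 h1 h4 h3 h5
  iSup := by
    rw [eq_top_iff, ← h.iSup]
    refine iSup_le fun μ => le_trans ?_ (le_iSup _ (-μ))
    intro v hv
    rw [End.mem_eigenspace_iff] at hv ⊢
    simp [hv]
  fin μ := by
    have := h.fin (-μ)
    refine Submodule.finiteDimensional_of_le (S₂ := H.eigenspace (-μ)) fun v hv => ?_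
    rw [End.mem_eigenspace_iff] at hv ⊢
    rw [neg_smul, ← hv]; simp
  ntriv := h.ntriv

lemma commute_of_mem_span {Z : ι → End ℂ M} {u D : End ℂ M} (hZ : ∀ i, Commute u (Z i))
    (hD : D ∈ Submodule.span ℂ (Set.range Z)) : Commute u D := by
  induction hD using Submodule.span_induction with
  | mem x hx => obtain ⟨i, rfl⟩ := hx; exact hZ i
  | zero => exact Commute.zero_right u
  | add x y _ _ hx hy => exact hx.add_right hy
  | smul a x _ hx => exact hx.smul_right a

lemma commute_XX (h : OpSys E F H X Y S) (i j : ι) : Commute (X i) (X j) :=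
  LinearMap.ext (h.XX i j)

lemma commute_XY (h : OpSys E F H X Y S) (i j : ι) : Commute (X i) (Y j) :=
  LinearMap.ext (h.XY i j)

lemma commute_YY (h : OpSys E F H X Y S) (i j : ι) : Commute (Y i) (Y j) :=
  LinearMap.ext (h.YY i j)

/-! ### Generalized eigenspaces as submodules -/

lemma maxGenEigenspace_X (h : OpSys E F H X Y S) (i : ι) (c : ℂ) :
    (X i).maxGenEigenspace c = ⊥ ∨ (X i).maxGenEigenspace c = ⊤ := by
  refine h.irr _ (fun v hv => ?_) (fun v hv => ?_) (fun j v hv => ?_) (fun j v hv => ?_)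
    (fun A hA v hv => ?_)
  · exact apply_mem_maxGenEigenspace_of_commutator (D := 0) (by simp [h.EX])
      (Commute.zero_right _) hv
  · exact apply_mem_maxGenEigenspace_of_commutator (D := -Y i) (by simp [h.FX])
      (h.commute_XY i i).neg_right hv
  · exact End.mapsTo_maxGenEigenspace_of_comm (h.commute_XX i j) c hv
  · exact End.mapsTo_maxGenEigenspace_of_comm (h.commute_XY i j) c hv
  · obtain ⟨D, hD, hAD⟩ := h.AX A hA i
    exact apply_mem_maxGenEigenspace_of_commutator (D := -D) (by simp [hAD])
      (commute_of_mem_span (h.commute_XX i) hD).neg_right hv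

/-- All commutators of X_i Y_i with the generators are polynomials in the X's and Y's: [E, X_i Y_i]
= X_i², [F, X_i Y_i] = Y_i², and those with S are quadratic. Hence they commute with X_i Y_i. -/
lemma maxGenEigenspace_XY (h : OpSys E F H X Y S) (i : ι) (c : ℂ) :
    (X i * Y i).maxGenEigenspace c = ⊥ ∨ (X i * Y i).maxGenEigenspace c = ⊤ := by
  have hX : ∀ j, Commute (X i * Y i) (X j) := fun j =>
    (h.commute_XX i j).mul_left (h.commute_XY j i).symm
  have hY : ∀ j, Commute (X i * Y i) (Y j) := fun j =>
    (h.commute_XY i j).mul_left (h.commute_YY i j)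
  refine h.irr _ (fun v hv => ?_) (fun v hv => ?_) (fun j v hv => ?_) (fun j v hv => ?_)
    (fun A hA v hv => ?_)
  · exact apply_mem_maxGenEigenspace_of_commutator (D := -(X i * X i))
      (by simp [h.EX, h.EY]) ((hX i).mul_right (hX i)).neg_right hv
  · exact apply_mem_maxGenEigenspace_of_commutator (D := -(Y i * Y i))
      (by simp [h.FX, h.FY]) ((hY i).mul_right (hY i)).neg_right hv
  · exact End.mapsTo_maxGenEigenspace_of_comm (hX j) c hv
  · exact End.mapsTo_maxGenEigenspace_of_comm (hY j) c hv
  · obtain ⟨D, hD, hAD⟩ := h.AX A hA i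
    obtain ⟨D', hD', hAD'⟩ := h.AY A hA i
    refine apply_mem_maxGenEigenspace_of_commutator (D := -(D * Y i + X i * D'))
      (by simp [hAD, hAD']; intro v; abel) ?_ hv
    exact (((commute_of_mem_span hX hD).mul_right (hY i)).add_right
      ((hX i).mul_right (commute_of_mem_span hY hD'))).neg_right

lemma injective_of_ker {u : End ℂ M} (hu : u.maxGenEigenspace 0 = ⊥) {v : M} (hv : u v = 0) :
    v = 0 := by
  rw [← Submodule.mem_bot ℂ, ← hu]
  exact (End.mem_maxGenEigenspace u 0 v).2 ⟨1, by simpa using hv⟩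

lemma exists_pow_apply {u : End ℂ M} {c : ℂ} (hu : u.maxGenEigenspace c = ⊤) (v : M) :
    ∃ k, ((u - c • (1 : End ℂ M)) ^ k) v = 0 :=
  (End.mem_maxGenEigenspace u c v).1 (hu ▸ Submodule.mem_top)

/-- A locally nilpotent operator is nilpotent on every finite dimensional subspace. -/
lemma exists_pow_uniform {u : End ℂ M} (hu : ∀ v, ∃ k, (u ^ k) v = 0) (W : Submodule ℂ M)
    [FiniteDimensional ℂ W] : ∃ d, ∀ v ∈ W, (u ^ d) v = 0 := by
  obtain ⟨s, hs⟩ := (IsNoetherian.noetherian (⊤ : Submodule ℂ W))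
  choose k hk using hu
  refine ⟨s.sup fun v => k v, fun v hv => ?_⟩
  have : (⟨v, hv⟩ : W) ∈ Submodule.span ℂ (s : Set W) := hs ▸ Submodule.mem_top
  have key : ∀ w ∈ Submodule.span ℂ (s : Set W), (u ^ (s.sup fun v => k v)) (w : M) = 0 := by
    intro w hw
    induction hw using Submodule.span_induction with
    | mem x hx =>
      obtain ⟨m, hm⟩ := Nat.exists_eq_add_of_le' (Finset.le_sup (f := fun v : W => k v) hx)
      rw [hm, pow_add, End.mul_apply, hk, map_zero]
    | zero => simp
    | add x y _ _ hx hy => simp [hx, hy]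
    | smul a x _ hx => simp [hx]
  exact key _ this

/-! ### Weight shifts -/

lemma X_mem (h : OpSys E F H X Y S) (i : ι) {μ : ℂ} {v : M} (hv : v ∈ H.eigenspace μ) :
    X i v ∈ H.eigenspace (μ + 1) := by
  rw [End.mem_eigenspace_iff] at hv ⊢
  simp [h.HX, hv, add_smul]

lemma Y_mem (h : OpSys E F H X Y S) (i : ι) {μ : ℂ} {v : M} (hv : v ∈ H.eigenspace μ) :
    Y i v ∈ H.eigenspace (μ - 1) := by
  rw [End.mem_eigenspace_iff] at hv ⊢
  simp [h.HY, hv, sub_smul]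

lemma E_mem (h : OpSys E F H X Y S) {μ : ℂ} {v : M} (hv : v ∈ H.eigenspace μ) :
    E v ∈ H.eigenspace (μ + 2) := by
  rw [End.mem_eigenspace_iff] at hv ⊢
  simp [h.HE, hv, add_smul]

lemma F_mem (h : OpSys E F H X Y S) {μ : ℂ} {v : M} (hv : v ∈ H.eigenspace μ) :
    F v ∈ H.eigenspace (μ - 2) := by
  rw [End.mem_eigenspace_iff] at hv ⊢
  simp [h.HF, hv, sub_smul]

lemma A_mem (h : OpSys E F H X Y S) {A : End ℂ M} (hA : A ∈ S) {μ : ℂ} {v : M}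
    (hv : v ∈ H.eigenspace μ) : A v ∈ H.eigenspace μ := by
  -- A commutes with E and F, hence with their commutator H.
  have hH : ∀ v, H v = E (F v) - F (E v) := fun v => by simp [h.EF]
  rw [End.mem_eigenspace_iff] at hv ⊢
  rw [← map_smul, ← hv, hH, hH, map_sub, h.AE A hA, h.AF A hA, h.AF A hA, h.AE A hA]

lemma Y_pow_mem (h : OpSys E F H X Y S) (i : ι) {μ : ℂ} {v : M} (hv : v ∈ H.eigenspace μ)
    (k : ℕ) : (Y i ^ k) v ∈ H.eigenspace (μ - k) := by
  induction k with
  | zero => simpa using hv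
  | succ k ih =>
    rw [pow_succ', End.mul_apply]
    convert h.Y_mem i ih using 2
    push_cast; ring

lemma F_pow_mem (h : OpSys E F H X Y S) {μ : ℂ} {v : M} (hv : v ∈ H.eigenspace μ)
    (k : ℕ) : (F ^ k) v ∈ H.eigenspace (μ - 2 * k) := by
  induction k with
  | zero => simpa using hv
  | succ k ih =>
    rw [pow_succ', End.mul_apply]
    convert h.F_mem ih using 2
    push_cast; ring

/-! ### The unique generalized eigenvalue of X i * Y i is zero -/

lemma exists_weight (h : OpSys E F H X Y S) : ∃ μ, ∃ v ∈ H.eigenspace μ, v ≠ 0 := by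
  by_contra! hc
  have : (⨆ μ, H.eigenspace μ) = ⊥ := by
    rw [eq_bot_iff]
    exact iSup_le fun μ v hv => (Submodule.mem_bot ℂ).2 (hc μ v hv)
  have hn := h.ntriv
  exact bot_ne_top (this.symm.trans h.iSup)

/-- `X i * Y i` has only one generalized eigenvalue. -/
lemma exists_maxGenEigenspace_XY (h : OpSys E F H X Y S) (i : ι) :
    ∃ c, (X i * Y i).maxGenEigenspace c = ⊤ := by
  obtain ⟨μ, v, hv, hv0⟩ := h.exists_weight
  have := h.fin μ
  have hmaps : ∀ w ∈ H.eigenspace μ, (X i * Y i) w ∈ H.eigenspace μ := fun w hw => by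
    simpa using h.X_mem i (h.Y_mem i hw)
  have : Nontrivial (H.eigenspace μ) := ⟨⟨v, hv⟩, 0, by simpa using hv0⟩
  obtain ⟨c, hc⟩ := End.exists_eigenvalue ((X i * Y i).restrict hmaps)
  obtain ⟨w, hw, hw0⟩ := hc.exists_hasEigenvector
  refine ⟨c, (h.maxGenEigenspace_XY i c).resolve_left fun hb => hw0 ?_⟩
  have h1 : (X i * Y i) w = c • (w : M) := congrArg Subtype.val (End.mem_eigenspace_iff.1 hw)
  have h2 : (w : M) ∈ (X i * Y i).maxGenEigenspace c :=
    (End.mem_maxGenEigenspace _ c _).2 ⟨1, by simpa [sub_eq_zero] using h1⟩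
  rw [hb, Submodule.mem_bot] at h2
  exact Subtype.ext h2

/-- For c ≠ 0 put w = X_i Y_i - c. Finite-dimensionality gives w^d = 0 on all weight spaces μ + 2k
simultaneously; since [E, w] = X_i², applying E trades each factor w for X_i², ending in X_i^{2d} v
= 0 with X_i injective. -/
lemma maxGenEigenspace_XY_zero (h : OpSys E F H X Y S) (i : ι) :
    (X i * Y i).maxGenEigenspace 0 = ⊤ := by
  obtain ⟨c, hc⟩ := h.exists_maxGenEigenspace_XY i
  rcases eq_or_ne c 0 with rfl | hc0
  · exact hc
  exfalso
  have hinj : ∀ v, (X i * Y i) v = 0 → v = 0 := by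
    intro v hv
    obtain ⟨k, hk⟩ := exists_pow_apply hc v
    -- On the kernel of X_i Y_i the locally nilpotent operator X_i Y_i - c is the nonzero scalar -c.
    have : ∀ k, ((X i * Y i - c • 1) ^ k) v = (-c) ^ k • v := by
      intro k
      induction k with
      | zero => simp
      | succ k ih =>
        rw [pow_succ', End.mul_apply, ih, map_smul, LinearMap.sub_apply, hv, pow_succ, mul_smul]
        simp
    rw [this] at hk
    exact (smul_eq_zero.1 hk).resolve_left (pow_ne_zero _ (neg_ne_zero.2 hc0))
  have hYinj : ∀ k v, (Y i ^ k) v = 0 → v = 0 := by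
    intro k
    induction k with
    | zero => intro v hv; simpa using hv
    | succ k ih =>
      intro v hv
      rw [pow_succ, End.mul_apply] at hv
      exact hinj v (by simp [ih _ hv])
  have hXinj : ∀ k v, (X i ^ k) v = 0 → v = 0 := by
    intro k
    induction k with
    | zero => intro v hv; simpa using hv
    | succ k ih =>
      intro v hv
      rw [pow_succ, End.mul_apply] at hv
      exact hinj v (by simp [h.XY, ih _ hv])
  obtain ⟨μ, v, hv, hv0⟩ := h.exists_weight
  have := h.fin μ
  set w : End ℂ M := X i * Y i - c • 1 with hw
  obtain ⟨d, hd⟩ := exists_pow_uniform (exists_pow_apply hc) (H.eigenspace μ)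
  rw [← hw] at hd
  have hwX : Commute w (X i) :=
    ((h.commute_XX i i).mul_left (h.commute_XY i i).symm).sub_left
      ((Commute.one_left _).smul_left c)
  have hwY : Commute w (Y i) :=
    ((h.commute_XY i i).mul_left (h.commute_YY i i)).sub_left
      ((Commute.one_left _).smul_left c)
  have hEX : ∀ (j : ℕ) v, E ((X i ^ j) v) = (X i ^ j) (E v) := by
    intro j
    induction j with
    | zero => simp
    | succ j ih => intro v; rw [pow_succ, End.mul_apply, ih, h.EX, End.mul_apply]
  have hEw1 : ∀ v, E (w v) = w (E v) + (X i ^ 2) v := by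
    intro v; simp [hw, h.EX, h.EY, pow_two]; abel
  have hEw : ∀ (m : ℕ) v, E ((w ^ (m + 1)) v) =
      (w ^ (m + 1)) (E v) + ((m + 1 : ℕ) : ℂ) • (w ^ m) ((X i ^ 2) v) := by
    intro m
    induction m with
    | zero => intro v; simp [hEw1]
    | succ m ih =>
      intro v
      rw [pow_succ w (m + 1), End.mul_apply, ih, hEw1, map_add, End.mul_apply,
        ← End.mul_apply (X i ^ 2) w, ← (hwX.pow_right 2).eq, End.mul_apply,
        ← End.mul_apply (w ^ m) w, ← pow_succ]
      push_cast
      module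
  -- Y_i^{2k} embeds this weight space into weight μ and commutes with w, so the exponent d does not
  -- depend on k.
  have hpow : ∀ (k : ℕ) v, v ∈ H.eigenspace (μ + 2 * k) → (w ^ d) v = 0 := by
    intro k v hv
    refine hYinj (2 * k) _ ?_
    rw [← End.mul_apply, ← ((hwY.pow_left d).pow_right (2 * k)).eq, End.mul_apply]
    exact hd _ (by simpa using h.Y_pow_mem i hv (2 * k))
  -- The quantifier over k is needed in the induction: applying E leaves a term in E v, of weight μ
  -- + 2(k + 1), which also vanishes by the induction hypothesis.
  have key : ∀ j ≤ d, ∀ (k : ℕ) v, v ∈ H.eigenspace (μ + 2 * k) →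
      (w ^ (d - j)) ((X i ^ (2 * j)) v) = 0 := by
    intro j
    induction j with
    | zero => intro _ k v hv; simpa using hpow k v hv
    | succ j ih =>
      intro hj k v hv
      obtain ⟨m, hm⟩ : ∃ m, d - j = m + 1 := ⟨d - j - 1, by omega⟩
      have hm' : d - (j + 1) = m := by omega
      have ih := ih (by omega)
      rw [hm] at ih
      have h1 := hEw m ((X i ^ (2 * j)) v)
      rw [ih k v hv, map_zero, hEX, ih (k + 1) (E v) (by
        convert h.E_mem hv using 2; push_cast; ring), zero_add, eq_comm, smul_eq_zero] at h1
      have h2 := h1.resolve_left (Nat.cast_ne_zero.2 m.succ_ne_zero)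
      rw [hm', mul_add, mul_one, add_comm, pow_add, End.mul_apply]
      exact h2
  exact hv0 (hXinj (2 * d) v (by simpa using key d le_rfl 0 v (by simpa using hv)))

/-! ### X i locally nilpotent and Y i injective is impossible -/

lemma F_pow_Y (h : OpSys E F H X Y S) (i : ι) (k : ℕ) (v : M) :
    (F ^ k) (Y i v) = Y i ((F ^ k) v) := by
  induction k with
  | zero => simp
  | succ k ih => rw [pow_succ', End.mul_apply, ih, h.FY, End.mul_apply]

lemma X_F_pow (h : OpSys E F H X Y S) (i : ι) (k : ℕ) (v : M) :
    X i ((F ^ (k + 1)) v) = (F ^ (k + 1)) (X i v) - ((k + 1 : ℕ) : ℂ) • (F ^ k) (Y i v) := by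
  induction k with
  | zero => simp [h.FX]
  | succ k ih =>
    have h1 : X i (F ((F ^ (k + 1)) v)) = F (X i ((F ^ (k + 1)) v)) - Y i ((F ^ (k + 1)) v) := by
      rw [h.FX]; abel
    rw [pow_succ', End.mul_apply, h1, ih, map_sub, map_smul, ← End.mul_apply F, ← pow_succ',
      ← End.mul_apply F, ← pow_succ', ← h.F_pow_Y]
    push_cast
    module

/-- Each X_i moved to the right past the powers of F turns one F into -Y_i, with multiplicity; the
constant produced by the recursion is (-1)^m m!. -/
lemma X_pow_F_pow (h : OpSys E F H X Y S) (i : ι) {v : M} (hv : X i v = 0) (m : ℕ) :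
    ∃ c : ℂ, c ≠ 0 ∧ (X i ^ m) ((F ^ m) v) = c • (Y i ^ m) v := by
  have hXY : ∀ (m : ℕ) v, (X i ^ m) (Y i v) = Y i ((X i ^ m) v) := fun m v =>
    LinearMap.congr_fun ((h.commute_XY i i).pow_left m).eq v
  induction m with
  | zero => exact ⟨1, one_ne_zero, by simp⟩
  | succ m ih =>
    obtain ⟨c, hc, hcm⟩ := ih
    refine ⟨-((m + 1 : ℕ) : ℂ) * c,
      mul_ne_zero (neg_ne_zero.2 (Nat.cast_ne_zero.2 m.succ_ne_zero)) hc, ?_⟩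
    rw [pow_succ (X i), End.mul_apply, h.X_F_pow, hv, map_zero, zero_sub, h.F_pow_Y, map_neg,
      map_smul, hXY, hcm, map_smul, pow_succ' (Y i), End.mul_apply, neg_mul, neg_smul, mul_smul]

lemma Y_pow_injective (i : ι) (hY : ∀ v, Y i v = 0 → v = 0) (k : ℕ) :
    ∀ v, (Y i ^ k) v = 0 → v = 0 := by
  induction k with
  | zero => intro v hv; simpa using hv
  | succ k ih =>
    intro v hv
    rw [pow_succ, End.mul_apply] at hv
    exact hY _ (ih _ hv)

/-- For v in ker X_i of weight μ + 2j, F^j v has weight μ, where X_i^d = 0. So for j ≥ d the vector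
X_i^j F^j v, a nonzero multiple of Y_i^j v, vanishes, and Y_i is injective. -/
lemma ker_X_bounded (h : OpSys E F H X Y S) (i : ι) (hX : ∀ v, ∃ k, (X i ^ k) v = 0)
    (hY : ∀ v, Y i v = 0 → v = 0) (μ : ℂ) :
    ∃ N : ℕ, ∀ m ≥ N, ∀ v ∈ H.eigenspace (μ + m), X i v = 0 → v = 0 := by
  have := h.fin μ
  obtain ⟨d, hd⟩ := exists_pow_uniform hX (H.eigenspace μ)
  have heven : ∀ j ≥ d, ∀ v ∈ H.eigenspace (μ + 2 * j), X i v = 0 → v = 0 := by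
    intro j hj v hv hXv
    obtain ⟨c, hc, hcv⟩ := h.X_pow_F_pow i hXv j
    have h1 : (F ^ j) v ∈ H.eigenspace μ := by simpa using h.F_pow_mem hv j
    obtain ⟨e, rfl⟩ := Nat.exists_eq_add_of_le' hj
    have h2 : (X i ^ (e + d)) ((F ^ (e + d)) v) = 0 := by
      rw [pow_add (X i), End.mul_apply, hd _ h1, map_zero]
    rw [h2, eq_comm, smul_eq_zero] at hcv
    exact Y_pow_injective i hY _ v (hcv.resolve_left hc)
  refine ⟨2 * d, fun m hm v hv hXv => ?_⟩
  obtain ⟨j, rfl | rfl⟩ := Nat.even_or_odd' m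
  · exact heven j (by omega) v (by simpa using hv) hXv
  -- Odd offset: Y_i v is again in ker X_i and lies one step lower, at an even offset.
  · refine hY v (heven j (by omega) _ ?_ (by rw [h.XY, hXv, map_zero]))
    convert h.Y_mem i hv using 2
    push_cast; ring

/-- In high weights X_i is injective, and it raises the weight, so all its powers are injective
there; local nilpotency leaves only zero. -/
lemma weights_bounded (h : OpSys E F H X Y S) (i : ι) (hX : ∀ v, ∃ k, (X i ^ k) v = 0)
    (hY : ∀ v, Y i v = 0 → v = 0) (μ : ℂ) :
    ∃ N : ℕ, ∀ m ≥ N, ∀ v ∈ H.eigenspace (μ + m), v = 0 := by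
  obtain ⟨N, hN⟩ := h.ker_X_bounded i hX hY μ
  have key : ∀ (k m : ℕ) v, N ≤ m → v ∈ H.eigenspace (μ + m) → (X i ^ k) v = 0 → v = 0 := by
    intro k
    induction k with
    | zero => intro m v _ _ hv; simpa using hv
    | succ k ih =>
      intro m v hm hv hk
      rw [pow_succ, End.mul_apply] at hk
      refine hN m hm v hv (ih (m + 1) _ (by omega) ?_ hk)
      convert h.X_mem i hv using 2
      push_cast; ring
  refine ⟨N, fun m hm v hv => ?_⟩
  obtain ⟨k, hk⟩ := hX v
  exact key k m v hm hv hk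

lemma exists_top_weight (h : OpSys E F H X Y S) (i : ι) (hX : ∀ v, ∃ k, (X i ^ k) v = 0)
    (hY : ∀ v, Y i v = 0 → v = 0) :
    ∃ μ, (∃ v ∈ H.eigenspace μ, v ≠ 0) ∧
      ∀ m : ℕ, 1 ≤ m → ∀ v ∈ H.eigenspace (μ + m), v = 0 := by
  classical
  obtain ⟨μ, v, hv, hv0⟩ := h.exists_weight
  have hb := h.weights_bounded i hX hY μ
  have hspec := Nat.find_spec hb
  have hmin := fun m => Nat.find_min hb (m := m)
  generalize Nat.find hb = N at hspec hmin
  -- N is the least bound. It is positive because v ≠ 0 has weight μ, and N - 1 fails to be a bound,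
  -- which produces the top weight.
  have hN : N ≠ 0 := by
    rintro rfl
    exact hv0 (hspec 0 le_rfl v (by simpa using hv))
  obtain ⟨k, rfl⟩ := Nat.exists_eq_succ_of_ne_zero hN
  have hk := hmin k (Nat.lt_succ_self k)
  push Not at hk
  obtain ⟨m, hm, w, hw, hw0⟩ := hk
  refine ⟨μ + m, ⟨w, hw, hw0⟩, fun l hl v hv => hspec (m + l) (by omega) v ?_⟩
  rwa [Nat.cast_add, ← add_assoc]

/-- The weights are bounded above by a top weight. -/
lemma iSup_below_top (h : OpSys E F H X Y S) {μ : ℂ} (hμ : ∃ v ∈ H.eigenspace μ, v ≠ 0)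
    (htop : ∀ m : ℕ, 1 ≤ m → ∀ v ∈ H.eigenspace (μ + m), v = 0) :
    ⨆ m : ℕ, H.eigenspace (μ - m) = ⊤ := by
  have stab : ∀ (G : End ℂ M), (∀ (m : ℕ), ∀ v ∈ H.eigenspace (μ - m),
      G v ∈ ⨆ m : ℕ, H.eigenspace (μ - m)) →
      ∀ v ∈ ⨆ m : ℕ, H.eigenspace (μ - m), G v ∈ ⨆ m : ℕ, H.eigenspace (μ - m) := by
    intro G hG
    have : (⨆ m : ℕ, H.eigenspace (μ - m)) ≤ (⨆ m : ℕ, H.eigenspace (μ - m)).comap G :=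
      iSup_le fun m v hv => hG m v hv
    exact this
  have mem : ∀ (m : ℕ) v, v ∈ H.eigenspace (μ - m) → v ∈ ⨆ m : ℕ, H.eigenspace (μ - m) :=
    fun m v hv => (le_iSup (fun m : ℕ => H.eigenspace (μ - m)) m) hv
  have up : ∀ (l m : ℕ) v, v ∈ H.eigenspace (μ - m + l) →
      v ∈ ⨆ m : ℕ, H.eigenspace (μ - m) := by
    intro l m v hv
    rcases le_or_gt l m with hlm | hlm
    · obtain ⟨j, rfl⟩ := Nat.exists_eq_add_of_le' hlm
      refine mem j v ?_
      convert hv using 2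
      push_cast; ring
    · obtain ⟨j, rfl⟩ := Nat.exists_eq_add_of_le' hlm.le
      rw [htop j (by omega) v (by convert hv using 2; push_cast; ring)]
      exact zero_mem _
  refine (h.irr _ (stab E fun m v hv => ?_) (stab F fun m v hv => ?_)
    (fun j => stab (X j) fun m v hv => ?_) (fun j => stab (Y j) fun m v hv => ?_)
    (fun A hA => stab A fun m v hv => mem m _ (h.A_mem hA hv))).resolve_left fun hb => ?_
  · exact up 2 m _ (by simpa using h.E_mem hv)
  · exact mem (m + 2) _ (by convert h.F_mem hv using 2; push_cast; ring)
  · exact up 1 m _ (by simpa using h.X_mem j hv)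
  · exact mem (m + 1) _ (by convert h.Y_mem j hv using 2; push_cast; ring)
  · obtain ⟨v, hv, hv0⟩ := hμ
    exact hv0 ((Submodule.mem_bot ℂ).1 (hb ▸ mem 0 v (by simpa using hv)))

/-- The subspace `∑ F^k Y_j K` generated by the common kernel `K` of the `X_j`. -/
def descent (F : End ℂ M) (X Y : ι → End ℂ M) : Submodule ℂ M :=
  Submodule.span ℂ {m | ∃ (k : ℕ) (j : ι) (w : M), (∀ i, X i w = 0) ∧ m = (F ^ k) (Y j w)}

lemma mem_descent {w : M} (hw : ∀ i, X i w = 0) (k : ℕ) (j : ι) :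
    (F ^ k) (Y j w) ∈ descent F X Y :=
  Submodule.subset_span ⟨k, j, w, hw, rfl⟩

lemma descent_stable {G : End ℂ M}
    (hG : ∀ (k : ℕ) (j : ι) (w : M), (∀ i, X i w = 0) → G ((F ^ k) (Y j w)) ∈ descent F X Y) :
    ∀ v ∈ descent F X Y, G v ∈ descent F X Y := by
  have : descent F X Y ≤ (descent F X Y).comap G := by
    refine Submodule.span_le.2 ?_
    rintro _ ⟨k, j, w, hw, rfl⟩
    exact hG k j w hw
  exact this

/-- The common kernel of the X_i is stable under E, H, S and the Y_j. For w in it, E Y_j w = Y_j E w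
and X_i Y_j w = 0; induction on k then carries E and X_i past F^k, with corrections H and -Y_i that
also preserve the span. -/
lemma descent_eq (h : OpSys E F H X Y S) : descent F X Y = ⊥ ∨ descent F X Y = ⊤ := by
  have hF : ∀ v ∈ descent F X Y, F v ∈ descent F X Y := descent_stable fun k j w hw => by
    rw [← End.mul_apply, ← pow_succ']
    exact mem_descent hw _ _
  have hY : ∀ i, ∀ v ∈ descent F X Y, Y i v ∈ descent F X Y := fun i =>
    descent_stable fun k j w hw => by
      rw [← h.F_pow_Y, h.YY]
      exact mem_descent (fun l => by rw [h.XY, hw, map_zero]) _ _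
  have hEw : ∀ w, (∀ i, X i w = 0) → ∀ i, X i (E w) = 0 := fun w hw i => by
    rw [← h.EX, hw, map_zero]
  have hHw : ∀ w, (∀ i, X i w = 0) → ∀ i, X i (H w) = 0 := fun w hw i => by
    have := h.HX i w
    rw [hw, map_zero, add_zero] at this
    exact this.symm
  have hHk : ∀ (k : ℕ) (j : ι) (w : M), (∀ i, X i w = 0) →
      H ((F ^ k) (Y j w)) ∈ descent F X Y := by
    intro k j w hw
    induction k with
    | zero =>
      have := sub_mem (mem_descent (F := F) (Y := Y) (hHw w hw) 0 j) (mem_descent hw 0 j)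
      simpa [h.HY] using this
    | succ k ih =>
      rw [pow_succ', End.mul_apply, h.HF]
      exact sub_mem (hF _ ih) (Submodule.smul_mem _ _ (hF _ (mem_descent hw k j)))
  refine h.irr _ (descent_stable fun k j w hw => ?_) hF
    (fun i => descent_stable fun k j w hw => ?_) hY
    (fun A hA => descent_stable fun k j w hw => ?_)
  · induction k with
    | zero => simpa [h.EY, hw] using mem_descent (F := F) (Y := Y) (hEw w hw) 0 j
    | succ k ih =>
      rw [pow_succ', End.mul_apply, h.EF]
      exact add_mem (hF _ ih) (hHk k j w hw)
  · induction k with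
    | zero => simp [h.XY, hw]
    | succ k ih =>
      have h1 : X i (F ((F ^ k) (Y j w))) = F (X i ((F ^ k) (Y j w))) - Y i ((F ^ k) (Y j w)) := by
        rw [h.FX]; abel
      rw [pow_succ', End.mul_apply, h1]
      exact sub_mem (hF _ ih) (hY i _ (mem_descent hw k j))
  · induction k with
    | zero =>
      obtain ⟨D, hD, hAD⟩ := h.AY A hA j
      have hAw : ∀ i, X i (A w) = 0 := fun i => by
        obtain ⟨D', hD', hAD'⟩ := h.AX A hA i
        have hD'w : D' w = 0 := by
          have : Submodule.span ℂ (Set.range X) ≤ LinearMap.ker (LinearMap.applyₗ w) := by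
            refine Submodule.span_le.2 ?_
            rintro _ ⟨l, rfl⟩
            exact hw l
          exact this hD'
        have := hAD' w
        rw [hw, map_zero, hD'w, add_zero] at this
        exact this.symm
      have hDw : D w ∈ descent F X Y := by
        have : Submodule.span ℂ (Set.range Y) ≤
            (descent F X Y).comap (LinearMap.applyₗ w) := by
          refine Submodule.span_le.2 ?_
          rintro _ ⟨l, rfl⟩
          simpa using mem_descent (F := F) (Y := Y) hw 0 l
        exact this hD
      have := add_mem (mem_descent (F := F) (Y := Y) hAw 0 j) hDw
      simpa [hAD] using this
    | succ k ih =>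
      rw [pow_succ', End.mul_apply, h.AF A hA]
      exact hF _ ih

lemma not_nilpotent_and_injective (h : OpSys E F H X Y S) (i : ι)
    (hX : ∀ v, ∃ k, (X i ^ k) v = 0) (hY : ∀ v, Y i v = 0 → v = 0) : False := by
  obtain ⟨μ, ⟨v, hv, hv0⟩, htop⟩ := h.exists_top_weight i hX hY
  have hQ := h.iSup_below_top ⟨v, hv, hv0⟩ htop
  have hXv : ∀ j, X j v = 0 := fun j => htop 1 le_rfl _ (by simpa using h.X_mem j hv)
  set P : Submodule ℂ M := ⨆ ν : ({μ}ᶜ : Set ℂ), H.eigenspace ν with hP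
  have memP : ∀ (m : ℕ) w, w ∈ H.eigenspace (μ - (m + 1 : ℕ)) → w ∈ P := fun m w hw =>
    (le_iSup (fun ν : ({μ}ᶜ : Set ℂ) => H.eigenspace (ν : ℂ)) ⟨μ - (m + 1 : ℕ), by
      simpa using Nat.cast_add_one_ne_zero m⟩) hw
  -- All weights are of the form μ - m, and F^k Y_j lowers by 1 + 2k > 0, so its image avoids weight
  -- μ.
  have hle : descent F X Y ≤ P := by
    refine Submodule.span_le.2 ?_
    rintro _ ⟨k, j, w, -, rfl⟩
    have : (⨆ m : ℕ, H.eigenspace (μ - m)) ≤ P.comap (F ^ k * Y j) := by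
      refine iSup_le fun m w hw => memP (m + 2 * k) _ ?_
      rw [show μ - ((m + 2 * k + 1 : ℕ) : ℂ) = μ - m - 1 - 2 * k by push_cast; ring]
      exact h.F_pow_mem (h.Y_mem j hw) k
    exact this (hQ ▸ Submodule.mem_top)
  have hdisj : Disjoint (H.eigenspace μ) P := by
    have := (End.eigenspaces_iSupIndep H) μ
    rwa [iSup_subtype']  at this
  have hb : descent F X Y = ⊥ := h.descent_eq.resolve_right fun ht => hv0 <| by
    have h1 : v ∈ P := hle (ht ▸ Submodule.mem_top)
    exact (Submodule.disjoint_def.1 hdisj) v hv h1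
  have := mem_descent (F := F) (Y := Y) hXv 0 i
  rw [hb, Submodule.mem_bot] at this
  exact hv0 (hY v (by simpa using this))

/-! ### Local nilpotency and the common kernel -/

/-- Otherwise both are injective, so X_i Y_i is injective and locally nilpotent on a nonzero space.
-/
lemma X_or_Y_nilpotent (h : OpSys E F H X Y S) (i : ι) :
    (∀ v, ∃ k, (X i ^ k) v = 0) ∨ (∀ v, ∃ k, (Y i ^ k) v = 0) := by
  rcases h.maxGenEigenspace_X i 0 with hX | hX
  · rcases h.swap.maxGenEigenspace_X i 0 with hY | hY
    · exfalso
      obtain ⟨v, hv0⟩ := (nontrivial_iff_exists_ne (0 : M)).1 h.ntriv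
      obtain ⟨k, hk⟩ := exists_pow_apply (h.maxGenEigenspace_XY_zero i) v
      rw [zero_smul, sub_zero] at hk
      have : ∀ (k : ℕ) v, ((X i * Y i) ^ k) v = 0 → v = 0 := by
        intro k
        induction k with
        | zero => intro v hv; simpa using hv
        | succ k ih =>
          intro v hv
          rw [pow_succ, End.mul_apply] at hv
          exact injective_of_ker hY (injective_of_ker hX (ih _ hv))
      exact hv0 (this k v hk)
    · exact .inr fun v => by simpa using exists_pow_apply hY v
  · exact .inl fun v => by simpa using exists_pow_apply hX v

lemma X_nilpotent (h : OpSys E F H X Y S) (i : ι) (v : M) : ∃ k, (X i ^ k) v = 0 := by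
  rcases h.X_or_Y_nilpotent i with hX | hY
  · exact hX v
  · rcases h.maxGenEigenspace_X i 0 with hX | hX
    · exact (h.swap.not_nilpotent_and_injective i hY fun v hv => injective_of_ker hX hv).elim
    · simpa using exists_pow_apply hX v

/-- Finitely many commuting locally nilpotent operators have a common kernel. -/
lemma exists_common_kernel {κ : Type*} [Nontrivial M] (Z : κ → End ℂ M)
    (hcomm : ∀ i j, Commute (Z i) (Z j)) (hnil : ∀ i v, ∃ k, (Z i ^ k) v = 0) (s : Finset κ) :
    ∃ v ≠ 0, ∀ i ∈ s, Z i v = 0 := by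
  classical
  induction s using Finset.induction_on with
  | empty =>
    obtain ⟨v, hv⟩ := exists_ne (0 : M)
    exact ⟨v, hv, by simp⟩
  | insert a s _ ih =>
    obtain ⟨v, hv, hs⟩ := ih
    have hmin := fun m => Nat.find_min (hnil a v) (m := m)
    have hspec := Nat.find_spec (hnil a v)
    generalize Nat.find (hnil a v) = N at hspec hmin
    obtain ⟨k, rfl⟩ := Nat.exists_eq_succ_of_ne_zero (n := N) (by
      rintro rfl; exact hv (by simpa using hspec))
    -- The last nonzero power of Z_a on v is killed by Z_a and, by commutativity, still by the
    -- earlier operators.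
    refine ⟨(Z a ^ k) v, hmin k (Nat.lt_succ_self k), fun i hi => ?_⟩
    rcases Finset.mem_insert.1 hi with rfl | hi
    · rwa [← End.mul_apply, ← pow_succ']
    · rw [← End.mul_apply, ((hcomm i a).pow_right k).eq, End.mul_apply, hs i hi, map_zero]

theorem X_Y_eq_zero [Finite ι] (h : OpSys E F H X Y S) (i : ι) : X i = 0 ∧ Y i = 0 := by
  cases nonempty_fintype ι
  have := h.ntriv
  let N : Submodule ℂ M := ⨅ j, (LinearMap.ker (X j) ⊓ LinearMap.ker (Y j))
  have hN : ∀ v, v ∈ N ↔ ∀ j, X j v = 0 ∧ Y j v = 0 := fun v => by simp [N]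
  have hne : N ≠ ⊥ := by
    obtain ⟨v, hv0, hv⟩ := exists_common_kernel (Sum.elim X Y)
      (by
        rintro (i | i) (j | j)
        exacts [h.commute_XX i j, h.commute_XY i j, (h.commute_XY j i).symm, h.commute_YY i j])
      (by
        rintro (i | i) v
        exacts [h.X_nilpotent i v, h.swap.X_nilpotent i v]) Finset.univ
    refine (Submodule.ne_bot_iff _).2 ⟨v, (hN v).2 fun j => ?_, hv0⟩
    exact ⟨hv (.inl j) (Finset.mem_univ _), hv (.inr j) (Finset.mem_univ _)⟩
  have span_zero : ∀ {Z : ι → End ℂ M} {v : M} {D : End ℂ M}, (∀ j, Z j v = 0) →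
      D ∈ Submodule.span ℂ (Set.range Z) → D v = 0 := by
    intro Z v D hv hD
    have : Submodule.span ℂ (Set.range Z) ≤ LinearMap.ker (LinearMap.applyₗ v) := by
      refine Submodule.span_le.2 ?_
      rintro _ ⟨l, rfl⟩
      exact hv l
    exact this hD
  have htop : N = ⊤ := by
    refine (h.irr N (fun v hv => ?_) (fun v hv => ?_) (fun l v hv => ?_) (fun l v hv => ?_)
      (fun A hA v hv => ?_)).resolve_left hne <;> rw [hN] at hv ⊢ <;> intro j
    · have hY := h.EY j v
      rw [(hv j).1, (hv j).2, map_zero, add_zero] at hY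
      exact ⟨by rw [← h.EX, (hv j).1, map_zero], hY.symm⟩
    · have hX := h.FX j v
      rw [(hv j).1, (hv j).2, map_zero, add_zero] at hX
      exact ⟨hX.symm, by rw [← h.FY, (hv j).2, map_zero]⟩
    · simp [(hv l).1]
    · simp [(hv l).2]
    · obtain ⟨D, hD, hAD⟩ := h.AX A hA j
      obtain ⟨D', hD', hAD'⟩ := h.AY A hA j
      have h1 := hAD v
      have h2 := hAD' v
      rw [(hv j).1, map_zero, span_zero (fun l => (hv l).1) hD, add_zero] at h1
      rw [(hv j).2, map_zero, span_zero (fun l => (hv l).2) hD', add_zero] at h2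
      exact ⟨h1.symm, h2.symm⟩
  have hall : ∀ v, X i v = 0 ∧ Y i v = 0 := fun v => (hN v).1 (htop ▸ Submodule.mem_top) i
  exact ⟨LinearMap.ext fun v => (hall v).1, LinearMap.ext fun v => (hall v).2⟩

end OpSys
end OpSys

/-! ### From the Schrödinger algebra to the operator relations -/

section Translate

/-- The raising element of `sl₂`. -/
def eSL2 : SL2 := LieAlgebra.SpecialLinear.single (0 : Fin 2) 1 (by decide) (1 : ℂ)

/-- The lowering element of `sl₂`. -/
def fSL2 : SL2 := LieAlgebra.SpecialLinear.single (1 : Fin 2) 0 (by decide) (1 : ℂ)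

lemma eSL2_val : (eSL2 : SL2).1 = !![0, 1; 0, 0] := by
  ext i j; fin_cases i <;> fin_cases j <;> simp [eSL2, Matrix.single]

lemma fSL2_val : (fSL2 : SL2).1 = !![0, 0; 1, 0] := by
  ext i j; fin_cases i <;> fin_cases j <;> simp [fSL2, Matrix.single]

lemma hSL2_val : (hSL2 : SL2).1 = !![1, 0; 0, -1] := by
  ext i j; fin_cases i <;> fin_cases j <;> simp [hSL2, Matrix.single]

lemma sl2_lie_val (B B' : SL2) : (⁅B, B'⁆ : SL2).1 = B.1 * B'.1 - B'.1 * B.1 := rfl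

lemma lie_e_f : ⁅eSL2, fSL2⁆ = hSL2 := Subtype.ext <| by
  rw [sl2_lie_val, eSL2_val, fSL2_val, hSL2_val]
  ext i j; fin_cases i <;> fin_cases j <;> simp

lemma lie_h_e : ⁅hSL2, eSL2⁆ = (2 : ℂ) • eSL2 := Subtype.ext <| by
  rw [sl2_lie_val, SetLike.val_smul, eSL2_val, hSL2_val]
  ext i j; fin_cases i <;> fin_cases j <;> simp; norm_num

lemma lie_h_f : ⁅hSL2, fSL2⁆ = -(2 : ℂ) • fSL2 := Subtype.ext <| by
  rw [sl2_lie_val, SetLike.val_smul, fSL2_val, hSL2_val]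
  ext i j; fin_cases i <;> fin_cases j <;> simp; norm_num

lemma sl2_decomp (B : SL2) : B = B.1 0 0 • hSL2 + B.1 0 1 • eSL2 + B.1 1 0 • fSL2 := by
  have ht : B.1 0 0 + B.1 1 1 = 0 := by
    rw [← Matrix.trace_fin_two]; exact B.2
  refine Subtype.ext ?_
  change B.1 = B.1 0 0 • hSL2.1 + B.1 0 1 • eSL2.1 + B.1 1 0 • fSL2.1
  rw [eSL2_val, fSL2_val, hSL2_val]
  ext i j; fin_cases i <;> fin_cases j <;> simp
  linear_combination ht

variable {n : ℕ}

/-- The basis element `e_i`. -/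
def Heis.ex (i : Fin n) : Heis n := ⟨Pi.single i 1, 0, 0⟩

/-- The basis element `e_{n+i}`. -/
def Heis.ey (i : Fin n) : Heis n := ⟨0, Pi.single i 1, 0⟩

/-- The coordinates of an element of the Heisenberg algebra, linearly. -/
def Heis.coords : Heis n →ₗ[ℂ] (Fin n → ℂ) × (Fin n → ℂ) × ℂ :=
  ⟨⟨Heis.toProd, fun _ _ => rfl⟩, fun _ _ => rfl⟩

lemma Heis.coords_apply (u : Heis n) : Heis.coords u = (u.x, u.y, u.c) := rfl

lemma Heis.decomp (u : Heis n) :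
    u = ∑ i, u.x i • Heis.ex i + ∑ i, u.y i • Heis.ey i + u.c • ⟨0, 0, 1⟩ := by
  refine Heis.toProd.injective (show Heis.coords _ = Heis.coords _ from ?_)
  simp only [map_add, map_sum, map_smul, Heis.coords_apply, Heis.ex, Heis.ey]
  refine Prod.ext ?_ (Prod.ext ?_ ?_)
  · ext j
    simp [Prod.fst_sum, Pi.single_apply]
  · ext j
    simp [Prod.fst_sum, Prod.snd_sum, Pi.single_apply]
  · simp [Prod.snd_sum]

variable {M : Type*} [AddCommGroup M] [Module ℂ M]
    [LieRingModule (Schrodinger n) M] [LieModule ℂ (Schrodinger n) M]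

lemma lie_comm_of_eq {L N : Type*} [LieRing L] [AddCommGroup N] [LieRingModule L N] {a b c : L} (h : ⁅a, b⁆ = c)
    (v : N) :
    ⁅a, ⁅b, v⁆⁆ = ⁅b, ⁅a, v⁆⁆ + ⁅c, v⁆ := by
  rw [leibniz_lie, h, add_comm]

lemma lie_levi_levi (g g' : SL2 × SO n) : ⁅levi n g, levi n g'⁆ = levi n ⁅g, g'⁆ :=
  ((levi n).map_lie g g').symm

lemma lie_heis_heis (u v : Heis n) : ⁅heis n u, heis n v⁆ = heis n ⁅u, v⁆ :=
  ((heis n).map_lie u v).symm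

lemma lie_levi_heis (g : SL2 × SO n) (u : Heis n) :
    ⁅levi n g, heis n u⁆ = heis n (actFun g.1.1 g.2.1 u) := by
  simp

lemma schr_decomp (s : Schrodinger n) :
    s = levi n (s.right.1, 0) + levi n (0, s.right.2) + heis n s.left := by
  ext <;> simp

lemma act_e_ex (i : Fin n) : actFun eSL2.1 0 (Heis.ex i) = 0 := by
  ext <;> simp [eSL2_val, Heis.ex]

lemma act_e_ey (i : Fin n) : actFun eSL2.1 0 (Heis.ey i) = Heis.ex i := by
  ext <;> simp [eSL2_val, Heis.ex, Heis.ey]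

lemma act_f_ex (i : Fin n) : actFun fSL2.1 0 (Heis.ex i) = Heis.ey i := by
  ext <;> simp [fSL2_val, Heis.ex, Heis.ey]

lemma act_f_ey (i : Fin n) : actFun fSL2.1 0 (Heis.ey i) = 0 := by
  ext <;> simp [fSL2_val, Heis.ey]

lemma act_h_ex (i : Fin n) : actFun hSL2.1 0 (Heis.ex i) = Heis.ex i := by
  ext <;> simp [hSL2_val, Heis.ex]

lemma act_h_ey (i : Fin n) : actFun hSL2.1 0 (Heis.ey i) = -Heis.ey i := by
  ext <;> simp [hSL2_val, Heis.ey]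

lemma act_so_ex (A : Matrix (Fin n) (Fin n) ℂ) (i : Fin n) :
    actFun 0 A (Heis.ex i) = ∑ k, A k i • Heis.ex k := by
  rw [Heis.decomp (actFun 0 A (Heis.ex i))]
  simp [Heis.ex]

lemma act_so_ey (A : Matrix (Fin n) (Fin n) ℂ) (i : Fin n) :
    actFun 0 A (Heis.ey i) = ∑ k, A k i • Heis.ey k := by
  rw [Heis.decomp (actFun 0 A (Heis.ey i))]
  simp [Heis.ey]

lemma heis_heis_comm (hz : ∀ m : M, ⁅zElt n, m⁆ = 0) (u w : Heis n) (v : M) :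
    ⁅heis n u, ⁅heis n w, v⁆⁆ = ⁅heis n w, ⁅heis n u, v⁆⁆ := by
  have h1 : heis n ⁅u, w⁆ = ⁅u, w⁆.c • zElt n := by
    rw [zElt, ← map_smul]
    congr 1
    ext <;> simp
  rw [lie_comm_of_eq ((lie_heis_heis u w).trans h1), smul_lie, hz, smul_zero, add_zero]

/-- The action of `s ∈ s_n` as a linear operator. -/
abbrev opr (M : Type*) [AddCommGroup M] [Module ℂ M]
    [LieRingModule (Schrodinger n) M] [LieModule ℂ (Schrodinger n) M] (s : Schrodinger n) :
    End ℂ M := LieModule.toEnd ℂ (Schrodinger n) M s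

/-- The vanishing of `z` enters in the commutativity of the X's and Y's, and in showing that a
subspace stable under the listed operators is stable under all of s_n. -/
lemma opSys (hirr : LieModule.IsIrreducible ℂ (Schrodinger n) M) (hHC : IsHarishChandra n M)
    (hz : ∀ m : M, ⁅zElt n, m⁆ = 0) :
    OpSys (opr M (levi n (eSL2, 0))) (opr M (levi n (fSL2, 0))) (opr M (hElt n))
      (fun i : Fin n => opr M (heis n (Heis.ex i))) (fun i => opr M (heis n (Heis.ey i)))
      (Set.range fun A : SO n => opr M (levi n (0, A))) := by
  have hlev : ∀ (g g' : SL2 × SO n) (v : M),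
      ⁅levi n g, ⁅levi n g', v⁆⁆ = ⁅levi n g', ⁅levi n g, v⁆⁆ + ⁅levi n ⁅g, g'⁆, v⁆ :=
    fun g g' v => lie_comm_of_eq (lie_levi_levi g g') v
  have hact : ∀ (g : SL2 × SO n) (u u' : Heis n), actFun g.1.1 g.2.1 u = u' → ∀ v : M,
      ⁅levi n g, ⁅heis n u, v⁆⁆ = ⁅heis n u, ⁅levi n g, v⁆⁆ + ⁅heis n u', v⁆ :=
    fun g u u' h v => lie_comm_of_eq ((lie_levi_heis g u).trans (by rw [h])) v
  have hb : ∀ B B' : SL2, ⁅((B, 0) : SL2 × SO n), ((B', 0) : SL2 × SO n)⁆ = (⁅B, B'⁆, 0) :=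
    fun B B' => Prod.ext rfl (lie_self 0)
  have hb' : ∀ (A : SO n) (B : SL2), ⁅((0, A) : SL2 × SO n), ((B, 0) : SL2 × SO n)⁆ = 0 :=
    fun A B => Prod.ext (zero_lie _) (lie_zero _)
  have hsm : ∀ (c : ℂ) (B : SL2), levi n (c • B, 0) = c • levi n (B, 0) := fun c B => by
    rw [← map_smul]; congr 1; ext1 <;> simp
  constructor
  · intro v
    have := hlev (eSL2, 0) (fSL2, 0) v
    rwa [hb, lie_e_f] at this
  · intro v
    have := hlev (hSL2, 0) (eSL2, 0) v
    rwa [hb, lie_h_e, hsm, smul_lie] at this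
  · intro v
    have := hlev (hSL2, 0) (fSL2, 0) v
    rwa [hb, lie_h_f, hsm, smul_lie, neg_smul, ← sub_eq_add_neg] at this
  · exact fun i v => hact (hSL2, 0) _ _ (act_h_ex i) v
  · intro i v
    have := hact (hSL2, 0) _ _ (act_h_ey i) v
    rwa [map_neg, neg_lie, ← sub_eq_add_neg] at this
  · intro i v
    have := hact (eSL2, 0) _ _ (act_e_ex i) v
    rwa [map_zero, zero_lie, add_zero] at this
  · exact fun i v => hact (eSL2, 0) _ _ (act_e_ey i) v
  · exact fun i v => hact (fSL2, 0) _ _ (act_f_ex i) v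
  · intro i v
    have := hact (fSL2, 0) _ _ (act_f_ey i) v
    rwa [map_zero, zero_lie, add_zero] at this
  · exact fun i j v => heis_heis_comm hz _ _ v
  · exact fun i j v => heis_heis_comm hz _ _ v
  · exact fun i j v => heis_heis_comm hz _ _ v
  · rintro _ ⟨A, rfl⟩ v
    have := hlev (0, A) (eSL2, 0) v
    rwa [hb', map_zero, zero_lie, add_zero] at this
  · rintro _ ⟨A, rfl⟩ v
    have := hlev (0, A) (fSL2, 0) v
    rwa [hb', map_zero, zero_lie, add_zero] at this
  · rintro _ ⟨A, rfl⟩ i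
    refine ⟨∑ k, A.1 k i • opr M (heis n (Heis.ex k)), Submodule.sum_mem _ fun k _ =>
      Submodule.smul_mem _ _ (Submodule.subset_span ⟨k, rfl⟩), fun v => ?_⟩
    have := hact (0, A) _ _ (act_so_ex A.1 i) v
    rw [map_sum, sum_lie] at this
    simp only [map_smul, smul_lie] at this
    rw [LinearMap.sum_apply]
    exact this
  · rintro _ ⟨A, rfl⟩ i
    refine ⟨∑ k, A.1 k i • opr M (heis n (Heis.ey k)), Submodule.sum_mem _ fun k _ =>
      Submodule.smul_mem _ _ (Submodule.subset_span ⟨k, rfl⟩), fun v => ?_⟩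
    have := hact (0, A) _ _ (act_so_ey A.1 i) v
    rw [map_sum, sum_lie] at this
    simp only [map_smul, smul_lie] at this
    rw [LinearMap.sum_apply]
    exact this
  · intro N hE hF hX hY hA
    have hH : ∀ v ∈ N, ⁅levi n (hSL2, 0), v⁆ ∈ N := fun v hv => by
      have := hlev (eSL2, 0) (fSL2, 0) v
      rw [hb, lie_e_f, ← sub_eq_iff_eq_add'] at this
      rw [← this]
      exact N.sub_mem (hE _ (hF _ hv)) (hF _ (hE _ hv))
    have hlie : ∀ (s : Schrodinger n), ∀ v ∈ N, ⁅s, v⁆ ∈ N := by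
      intro s v hv
      let T : Submodule ℂ (Schrodinger n) :=
        { carrier := {s | ⁅s, v⁆ ∈ N}
          add_mem' := fun {a b} ha hb => by
            rw [Set.mem_ofPred_eq, add_lie]; exact N.add_mem ha hb
          zero_mem' := by rw [Set.mem_ofPred_eq, zero_lie]; exact N.zero_mem
          smul_mem' := fun c a ha => by
            rw [Set.mem_ofPred_eq, smul_lie]; exact N.smul_mem c ha }
      have hT : ∀ s, s ∈ T ↔ ⁅s, v⁆ ∈ N := fun s => Iff.rfl
      rw [← hT, schr_decomp s]
      refine T.add_mem (T.add_mem ?_ (hA _ ⟨s.right.2, rfl⟩ v hv)) ?_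
      · have hd : levi n (s.right.1, 0) = s.right.1.1 0 0 • levi n (hSL2, 0) +
            s.right.1.1 0 1 • levi n (eSL2, 0) + s.right.1.1 1 0 • levi n (fSL2, 0) := by
          conv_lhs => rw [sl2_decomp s.right.1]
          rw [← hsm, ← hsm, ← hsm, ← map_add, ← map_add]
          congr 1; ext1 <;> simp
        rw [hd]
        exact T.add_mem (T.add_mem (T.smul_mem _ (hH v hv)) (T.smul_mem _ (hE v hv)))
          (T.smul_mem _ (hF v hv))
      · rw [Heis.decomp s.left, map_add, map_add, map_sum, map_sum]
        refine T.add_mem (T.add_mem (T.sum_mem fun i _ => ?_) (T.sum_mem fun i _ => ?_)) ?_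
        · rw [map_smul]; exact T.smul_mem _ (hX i v hv)
        · rw [map_smul]; exact T.smul_mem _ (hY i v hv)
        · rw [map_smul]
          refine T.smul_mem _ ((hT _).2 ?_)
          have := hz v
          rw [zElt] at this
          rw [this]
          exact N.zero_mem
    let N' : LieSubmodule ℂ (Schrodinger n) M := { N with lie_mem := fun {s v} hv => hlie s v hv }
    rcases eq_bot_or_eq_top N' with h | h
    · left
      exact congrArg LieSubmodule.toSubmodule h
    · right
      exact congrArg LieSubmodule.toSubmodule h
  · exact hHC.1.submodule_iSup_eq_top
  · exact hHC.2
  · exact LieModule.nontrivial_of_isIrreducible ℂ (Schrodinger n) M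

theorem heis_acts_by_zero (hirr : LieModule.IsIrreducible ℂ (Schrodinger n) M)
    (hHC : IsHarishChandra n M) (hz : ∀ m : M, ⁅zElt n, m⁆ = 0) (u : Heis n) (m : M) :
    ⁅heis n u, m⁆ = 0 := by
  have hs := opSys hirr hHC hz
  have hx : ∀ i, ⁅heis n (Heis.ex i), m⁆ = 0 := fun i =>
    LinearMap.congr_fun (hs.X_Y_eq_zero i).1 m
  have hy : ∀ i, ⁅heis n (Heis.ey i), m⁆ = 0 := fun i =>
    LinearMap.congr_fun (hs.X_Y_eq_zero i).2 m
  have hz' : ⁅heis n ⟨0, 0, 1⟩, m⁆ = 0 := hz m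
  rw [Heis.decomp u, map_add, map_add, map_sum, map_sum, add_lie, add_lie, sum_lie,
    sum_lie]
  simp only [map_smul, smul_lie, hx, hy, hz', smul_zero, Finset.sum_const_zero, add_zero]

end Translate

/-! ### Isotypic decomposition over commuting Lie algebras -/

section Isotypic

variable {K G V M : Type*} [LieRing K] [LieAlgebra ℂ K] [LieRing G] [LieAlgebra ℂ G]
  [AddCommGroup V] [Module ℂ V] [LieRingModule K V] [LieModule ℂ K V]
  [AddCommGroup M] [Module ℂ M] [LieRingModule K M] [LieModule ℂ K M]
  [LieRingModule G M] [LieModule ℂ G M]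

/-- Schur's lemma. -/
lemma exists_eq_smul_of_irreducible [FiniteDimensional ℂ V] (hV : LieModule.IsIrreducible ℂ K V)
    (φ : V →ₗ⁅ℂ,K⁆ V) : ∃ c : ℂ, ∀ v, φ v = c • v := by
  have := LieModule.nontrivial_of_isIrreducible ℂ K V
  obtain ⟨c, hc⟩ := End.exists_eigenvalue (φ : V →ₗ[ℂ] V)
  obtain ⟨w, hw, hw0⟩ := hc.exists_hasEigenvector
  let N : LieSubmodule ℂ K V :=
    { End.eigenspace (φ : V →ₗ[ℂ] V) c with
      lie_mem := fun {k v} hv => by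
        have hv : φ v = c • v := End.mem_eigenspace_iff.1 hv
        exact End.mem_eigenspace_iff.2 (by simp [hv]) }
  have hN : N = ⊤ := (eq_bot_or_eq_top N).resolve_left fun hb =>
    hw0 ((LieSubmodule.mem_bot w).1 (hb ▸ (show w ∈ N from hw)))
  exact ⟨c, fun v => End.mem_eigenspace_iff.1 (show v ∈ N from hN ▸ LieSubmodule.mem_top v)⟩

/-- Evaluation `V ⊗ Hom_K(V, M) → M`. -/
def evalMap (K V M : Type*) [LieRing K] [LieAlgebra ℂ K]
    [AddCommGroup V] [Module ℂ V] [LieRingModule K V] [LieModule ℂ K V]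
    [AddCommGroup M] [Module ℂ M] [LieRingModule K M] [LieModule ℂ K M] :
    V ⊗[ℂ] (V →ₗ⁅ℂ,K⁆ M) →ₗ[ℂ] M :=
  TensorProduct.lift (LinearMap.mk₂ ℂ (fun v (φ : V →ₗ⁅ℂ,K⁆ M) => φ v)
    (by simp) (by simp) (by simp) (by simp))

@[simp] lemma evalMap_tmul (v : V) (φ : V →ₗ⁅ℂ,K⁆ M) : evalMap K V M (v ⊗ₜ φ) = φ v := by
  simp [evalMap]

/-- Linearly independent homomorphisms out of V have independent images. Inductively, the w with
b_a(w) in the sum of the other images form a submodule of V. If it were V, the components of b_a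
along the others would be endomorphisms of V, scalars by Schur, making b_a a linear combination of
them. -/
lemma eq_zero_of_sum_eq_zero [FiniteDimensional ℂ V] (hV : LieModule.IsIrreducible ℂ K V)
    {κ : Type*} {b : κ → (V →ₗ⁅ℂ,K⁆ M)} (hb : LinearIndependent ℂ b) (s : Finset κ) :
    ∀ v : κ → V, ∑ i ∈ s, b i (v i) = 0 → ∀ i ∈ s, v i = 0 := by
  classical
  induction s using Finset.induction_on with
  | empty => simp
  | insert a s ha ih =>
    intro v hv
    rw [Finset.sum_insert ha] at hv
    let W : LieSubmodule ℂ K V :=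
      { carrier := {w | ∃ u : κ → V, b a w = ∑ i ∈ s, b i (u i)}
        add_mem' := by
          rintro w w' ⟨u, hu⟩ ⟨u', hu'⟩
          exact ⟨u + u', by simp [hu, hu', Finset.sum_add_distrib]⟩
        zero_mem' := ⟨0, by simp⟩
        smul_mem' := by
          rintro c w ⟨u, hu⟩
          exact ⟨c • u, by simp [hu, Finset.smul_sum]⟩
        lie_mem := by
          rintro k w ⟨u, hu⟩
          exact ⟨fun i => ⁅k, u i⁆, by simp [hu, lie_sum]⟩ }
    have hva : v a ∈ W := ⟨-v, by simpa using eq_neg_of_add_eq_zero_left hv⟩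
    rcases eq_bot_or_eq_top W with hW | hW
    · have hva0 : v a = 0 := (LieSubmodule.mem_bot _).1 (hW ▸ hva)
      rw [hva0, map_zero, zero_add] at hv
      intro i hi
      rcases Finset.mem_insert.1 hi with rfl | hi
      · exact hva0
      · exact ih v hv i hi
    · exfalso
      have hall : ∀ w, ∃ u : κ → V, b a w = ∑ i ∈ s, b i (u i) := fun w =>
        show w ∈ W from hW ▸ LieSubmodule.mem_top w
      choose u hu using hall
      -- The induction hypothesis makes the components unique, so the arbitrarily chosen u is linear
      -- and K-equivariant in w.
      have huniq : ∀ (u₁ u₂ : κ → V), ∑ i ∈ s, b i (u₁ i) = ∑ i ∈ s, b i (u₂ i) →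
          ∀ i ∈ s, u₁ i = u₂ i := fun u₁ u₂ h i hi =>
        sub_eq_zero.1 (ih (u₁ - u₂) (by simp [Finset.sum_sub_distrib, h]) i hi)
      have hscal : ∀ i ∈ s, ∃ c : ℂ, ∀ w, u w i = c • w := fun i hi =>
        exists_eq_smul_of_irreducible hV
          { toFun := fun w => u w i
            map_add' := fun w w' => huniq (u (w + w')) (u w + u w')
              (by simp [← hu, Finset.sum_add_distrib]) i hi
            map_smul' := fun c w => huniq (u (c • w)) (c • u w)
              (by simp [← hu, ← Finset.smul_sum]) i hi
            map_lie' := fun {k w} => huniq (u ⁅k, w⁆) (fun i => ⁅k, u w i⁆)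
              (by simp [← hu, ← lie_sum]) i hi }
      choose! c hc using hscal
      have hba : b a = ∑ i ∈ s, c i • b i := by
        ext w
        have : (∑ i ∈ s, c i • b i) w = ∑ i ∈ s, c i • b i w := by
          let ew : (V →ₗ⁅ℂ,K⁆ M) →ₗ[ℂ] M :=
            { toFun := fun φ => φ w, map_add' := fun _ _ => rfl, map_smul' := fun _ _ => rfl }
          exact map_sum ew _ s
        rw [this, hu]
        exact Finset.sum_congr rfl fun i hi => by rw [hc i hi, map_smul]
      refine hb.notMem_span_image (s := (s : Set κ)) (by simpa using ha) ?_
      rw [hba]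
      exact Submodule.sum_mem _ fun i hi => Submodule.smul_mem _ _
        (Submodule.subset_span ⟨i, hi, rfl⟩)

lemma evalMap_injective [FiniteDimensional ℂ V] (hV : LieModule.IsIrreducible ℂ K V) :
    Function.Injective (evalMap K V M) := by
  rw [injective_iff_map_eq_zero]
  intro t ht
  let b := Module.Free.chooseBasis ℂ (V →ₗ⁅ℂ,K⁆ M)
  obtain ⟨c, rfl⟩ := TensorProduct.eq_repr_basis_right b t
  rw [Finsupp.sum, map_sum] at ht
  simp only [evalMap_tmul] at ht
  have := eq_zero_of_sum_eq_zero hV b.linearIndependent c.support c ht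
  exact Finset.sum_eq_zero fun i hi => by simp [this i hi]

variable (hc : ∀ (g : G) (k : K) (m : M), ⁅g, ⁅k, m⁆⁆ = ⁅k, ⁅g, m⁆⁆)

/-- The action of `G` on `Hom_K(V, M)` coming from an action on `M` commuting with that of `K`. -/
@[reducible] def homLieRingModule : LieRingModule G (V →ₗ⁅ℂ,K⁆ M) where
  bracket g φ :=
    { (LieModule.toEnd ℂ G M g).comp (φ : V →ₗ[ℂ] M) with
      map_lie' := fun {k v} => by simp [hc] }
  add_lie g g' φ := LieModuleHom.ext fun v => add_lie g g' (φ v)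
  lie_add g φ ψ := LieModuleHom.ext fun v => lie_add g (φ v) (ψ v)
  leibniz_lie g g' φ := LieModuleHom.ext fun v => leibniz_lie g g' (φ v)

lemma homLieModule :
    letI := homLieRingModule (V := V) hc
    LieModule ℂ G (V →ₗ⁅ℂ,K⁆ M) :=
  letI := homLieRingModule (V := V) hc
  { smul_lie := fun c g φ => LieModuleHom.ext fun v => smul_lie c g (φ v)
    lie_smul := fun c g φ => LieModuleHom.ext fun v => lie_smul c g (φ v) }

variable (hirr : ∀ N : Submodule ℂ M, (∀ (k : K), ∀ m ∈ N, ⁅k, m⁆ ∈ N) →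
    (∀ (g : G), ∀ m ∈ N, ⁅g, m⁆ ∈ N) → N = ⊥ ∨ N = ⊤)
include hc hirr

/-- The image of `V ⊗ P` under evaluation is zero or everything, for `P` stable under `G`. -/
lemma map_evalMap_span (P : Submodule ℂ (V →ₗ⁅ℂ,K⁆ M))
    (hP : ∀ (g : G), ∀ φ ∈ P, (homLieRingModule hc).toBracket.bracket g φ ∈ P) :
    Submodule.span ℂ {m | ∃ φ ∈ P, ∃ v : V, φ v = m} = ⊥ ∨
      Submodule.span ℂ {m | ∃ φ ∈ P, ∃ v : V, φ v = m} = ⊤ := by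
  set N := Submodule.span ℂ {m | ∃ φ ∈ P, ∃ v : V, φ v = m} with hN
  refine hirr N (fun k m hm => ?_) (fun g m hm => ?_)
  · have : N ≤ N.comap (LieModule.toEnd ℂ K M k) := by
      refine Submodule.span_le.2 ?_
      rintro _ ⟨φ, hφ, v, rfl⟩
      exact Submodule.subset_span ⟨φ, hφ, ⁅k, v⁆, by simp⟩
    exact this hm
  · have : N ≤ N.comap (LieModule.toEnd ℂ G M g) := by
      refine Submodule.span_le.2 ?_
      rintro _ ⟨φ, hφ, v, rfl⟩
      exact Submodule.subset_span ⟨_, hP g φ hφ, v, rfl⟩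
    exact this hm

lemma evalMap_surjective {φ₀ : V →ₗ⁅ℂ,K⁆ M} (hφ₀ : φ₀ ≠ 0) :
    Function.Surjective (evalMap K V M) := by
  rw [← LinearMap.range_eq_top, eq_top_iff]
  have htop := (map_evalMap_span hc hirr (⊤ : Submodule ℂ (V →ₗ⁅ℂ,K⁆ M))
    (fun _ _ _ => Submodule.mem_top)).resolve_left fun hb => hφ₀ <| LieModuleHom.ext fun v => by
      rw [Submodule.span_eq_bot] at hb
      exact hb _ ⟨φ₀, Submodule.mem_top, v, rfl⟩
  rw [← htop]
  refine Submodule.span_le.2 ?_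
  rintro _ ⟨φ, -, v, rfl⟩
  exact ⟨v ⊗ₜ φ, evalMap_tmul v φ⟩

/-- For a nonzero submodule P, the image of V ⊗ P under evaluation is M; injectivity on V ⊗ Hom_K(V,
M) then forces P to be everything. -/
lemma hom_irreducible [FiniteDimensional ℂ V] (hV : LieModule.IsIrreducible ℂ K V)
    {φ₀ : V →ₗ⁅ℂ,K⁆ M} (hφ₀ : φ₀ ≠ 0) :
    letI := homLieRingModule (V := V) hc
    LieModule.IsIrreducible ℂ G (V →ₗ⁅ℂ,K⁆ M) := by
  let := homLieRingModule (V := V) hc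
  have : Nontrivial (V →ₗ⁅ℂ,K⁆ M) := ⟨φ₀, 0, hφ₀⟩
  refine LieModule.IsIrreducible.mk fun P hP => ?_
  have htop := (map_evalMap_span hc hirr P.toSubmodule
    (fun g φ hφ => P.lie_mem hφ)).resolve_left fun hb => hP <| by
      rw [Submodule.span_eq_bot] at hb
      rw [LieSubmodule.eq_bot_iff]
      exact fun φ hφ => LieModuleHom.ext fun v => hb _ ⟨φ, hφ, v, rfl⟩
  rw [eq_top_iff]
  intro ψ _
  by_contra hψ
  -- The functional f separates ψ from P, so id ⊗ f kills V ⊗ P but not v₀ ⊗ ψ.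
  obtain ⟨f, hfψ, hf⟩ := Submodule.exists_le_ker_of_notMem (p := P.toSubmodule) hψ
  have := LieModule.nontrivial_of_isIrreducible ℂ K V
  obtain ⟨v₀, hv₀⟩ := exists_ne (0 : V)
  have hle : Submodule.span ℂ {m | ∃ φ ∈ P.toSubmodule, ∃ v : V, φ v = m} ≤
      (LinearMap.ker (f.lTensor V)).map (evalMap K V M) := by
    refine Submodule.span_le.2 ?_
    rintro _ ⟨φ, hφ, v, rfl⟩
    have hfφ : f φ = 0 := hf hφ
    exact ⟨v ⊗ₜ φ, by simp [hfφ], evalMap_tmul v φ⟩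
  rw [htop] at hle
  obtain ⟨t, ht, hte⟩ := hle (Submodule.mem_top (x := ψ v₀))
  have hte' : t = v₀ ⊗ₜ ψ := evalMap_injective hV (by rw [hte, evalMap_tmul])
  rw [hte', SetLike.mem_coe, LinearMap.mem_ker, LinearMap.lTensor_tmul] at ht
  have := congrArg (TensorProduct.rid ℂ V) ht
  rw [TensorProduct.rid_tmul, map_zero, smul_eq_zero] at this
  exact this.elim hfψ hv₀

end Isotypic

/-- A finite dimensional nonzero submodule contains an irreducible one. -/
lemma exists_irreducible_of_finiteDimensional {K M : Type*} [LieRing K] [LieAlgebra ℂ K]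
    [AddCommGroup M] [Module ℂ M] [LieRingModule K M] [LieModule ℂ K M]
    (W : LieSubmodule ℂ K M) (hW : W ≠ ⊥) [FiniteDimensional ℂ W] :
    ∃ V : LieSubmodule ℂ K M, V ≤ W ∧ FiniteDimensional ℂ V ∧ LieModule.IsIrreducible ℂ K V := by
  have hex : ∃ d, ∃ V : LieSubmodule ℂ K M, V ≤ W ∧ V ≠ ⊥ ∧ Module.finrank ℂ V = d :=
    ⟨_, W, le_rfl, hW, rfl⟩
  classical
  -- A nonzero submodule of minimal dimension.
  obtain ⟨V, hVW, hV, hd⟩ := Nat.find_spec hex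
  have hmin := fun m => Nat.find_min hex (m := m)
  rw [← hd] at hmin
  have hfd : FiniteDimensional ℂ V :=
    Submodule.finiteDimensional_of_le (S₁ := V.toSubmodule) (S₂ := W.toSubmodule) hVW
  have : Nontrivial V := (LieSubmodule.nontrivial_iff_ne_bot ℂ K M).2 hV
  refine ⟨V, hVW, hfd, LieModule.IsIrreducible.mk fun N hN => ?_⟩
  by_contra hNt
  have hlt : Module.finrank ℂ N < Module.finrank ℂ V :=
    Submodule.finrank_lt (s := N.toSubmodule) (by simpa using hNt)
  have hfr : Module.finrank ℂ (N.map V.incl) = Module.finrank ℂ N :=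
    (Submodule.equivMapOfInjective (V.incl : V →ₗ[ℂ] M) Subtype.val_injective
      N.toSubmodule).symm.finrank_eq
  refine hmin _ hlt ⟨N.map V.incl, ?_, ?_, hfr⟩
  · rintro _ ⟨x, -, rfl⟩
    exact hVW x.2
  · intro hb
    apply hN
    rw [LieSubmodule.eq_bot_iff] at hb ⊢
    exact fun x hx => Subtype.ext (hb x ⟨x, hx, rfl⟩)

/-- An irreducible `sl₂`-module with a nonzero weight vector is a weight module. -/
lemma isWeightModule_of_irreducible {L : Type*} [AddCommGroup L] [Module ℂ L]
    [LieRingModule SL2 L] [LieModule ℂ SL2 L] (hL : LieModule.IsIrreducible ℂ SL2 L) {μ : ℂ}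
    {φ : L} (hφ : φ ∈ wtSpace hSL2 L μ) (hφ0 : φ ≠ 0) : IsWeightModule hSL2 L := by
  rw [IsWeightModule, DirectSum.isInternal_submodule_iff_iSupIndep_and_iSup_eq_top]
  refine ⟨End.eigenspaces_iSupIndep _, ?_⟩
  have hmem : ∀ ν x, x ∈ wtSpace hSL2 L ν → x ∈ ⨆ ν, wtSpace hSL2 L ν := fun ν x hx =>
    (le_iSup (wtSpace hSL2 L) ν) hx
  have hstab : ∀ (B : SL2), (∀ ν x, x ∈ wtSpace hSL2 L ν → ⁅B, x⁆ ∈ ⨆ ν, wtSpace hSL2 L ν) →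
      ∀ x ∈ ⨆ ν, wtSpace hSL2 L ν, ⁅B, x⁆ ∈ ⨆ ν, wtSpace hSL2 L ν := by
    intro B hB
    have : (⨆ ν, wtSpace hSL2 L ν) ≤
        (⨆ ν, wtSpace hSL2 L ν).comap (LieModule.toEnd ℂ SL2 L B) :=
      iSup_le fun ν x hx => hB ν x hx
    exact this
  have he := hstab eSL2 fun ν x hx => hmem (ν + 2) _ <| by
    rw [mem_wtSpace] at hx ⊢
    rw [lie_comm_of_eq lie_h_e, hx, lie_smul, smul_lie, add_smul]
  have hf := hstab fSL2 fun ν x hx => hmem (ν - 2) _ <| by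
    rw [mem_wtSpace] at hx ⊢
    rw [lie_comm_of_eq lie_h_f, hx, lie_smul, smul_lie, sub_smul, neg_smul, sub_eq_add_neg]
  have hh := hstab hSL2 fun ν x hx => by
    have := hmem ν x hx
    rw [mem_wtSpace] at hx
    rw [hx]
    exact Submodule.smul_mem _ _ this
  let N : LieSubmodule ℂ SL2 L :=
    { (⨆ ν, wtSpace hSL2 L ν) with
      lie_mem := fun {B x} hx => by
        rw [sl2_decomp B, add_lie, add_lie, smul_lie, smul_lie, smul_lie]
        exact add_mem (add_mem (Submodule.smul_mem _ _ (hh x hx))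
          (Submodule.smul_mem _ _ (he x hx))) (Submodule.smul_mem _ _ (hf x hx)) }
  have hN : N = ⊤ := (eq_bot_or_eq_top N).resolve_left fun hb =>
    hφ0 ((LieSubmodule.mem_bot φ).1 (hb ▸ (show φ ∈ N from hmem μ φ hφ)))
  exact congrArg LieSubmodule.toSubmodule hN

/-! ### The tensor decomposition of M -/

section Final

variable {n : ℕ}

/-- The inclusion of `so_n` into `s_n`. -/
def soIncl (n : ℕ) : SO n →ₗ⁅ℂ⁆ Schrodinger n where
  toFun A := levi n (0, A)
  map_add' A A' := by rw [← map_add]; congr 1; ext1 <;> simp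
  map_smul' c A := by rw [RingHom.id_apply, ← map_smul]; congr 1; ext1 <;> simp
  map_lie' {A A'} := by
    rw [← LieHom.map_lie]
    congr 1
    exact Prod.ext (lie_self 0).symm rfl

/-- The inclusion of `sl₂` into `s_n`. -/
def slIncl (n : ℕ) : SL2 →ₗ⁅ℂ⁆ Schrodinger n where
  toFun B := levi n (B, 0)
  map_add' A A' := by rw [← map_add]; congr 1; ext1 <;> simp
  map_smul' c A := by rw [RingHom.id_apply, ← map_smul]; congr 1; ext1 <;> simp
  map_lie' {A A'} := by
    rw [← LieHom.map_lie]
    congr 1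
    exact Prod.ext rfl (lie_self 0).symm

lemma soIncl_lie_slIncl (A : SO n) (B : SL2) : ⁅slIncl n B, soIncl n A⁆ = 0 := by
  have h : ⁅((B, 0) : SL2 × SO n), ((0, A) : SL2 × SO n)⁆ = 0 := Prod.ext (lie_zero _) (zero_lie _)
  exact (lie_levi_levi _ _).trans (by rw [h, map_zero])

variable {M : Type u} [AddCommGroup M] [Module ℂ M]
    [LieRingModule (Schrodinger n) M] [LieModule ℂ (Schrodinger n) M]

lemma lie_eq_of_heis_zero (h0 : ∀ (u : Heis n) (m : M), ⁅heis n u, m⁆ = 0) (s : Schrodinger n)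
    (m : M) : ⁅s, m⁆ = ⁅slIncl n s.right.1, m⁆ + ⁅soIncl n s.right.2, m⁆ := by
  conv_lhs => rw [schr_decomp s, add_lie, add_lie, h0, add_zero]
  rfl

lemma levi_irreducible (hirr : LieModule.IsIrreducible ℂ (Schrodinger n) M)
    (h0 : ∀ (u : Heis n) (m : M), ⁅heis n u, m⁆ = 0) :
    LieModule.IsIrreducible ℂ (levi n).range M := by
  have := LieModule.nontrivial_of_isIrreducible ℂ (Schrodinger n) M
  refine LieModule.IsIrreducible.mk fun N hN => ?_
  let N' : LieSubmodule ℂ (Schrodinger n) M :=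
    { N.toSubmodule with
      lie_mem := fun {s m} hm => by
        have h : s = levi n s.right + heis n s.left := by ext <;> simp
        rw [h, add_lie, h0, add_zero]
        exact N.lie_mem (x := ⟨levi n s.right, ⟨s.right, rfl⟩⟩) hm }
  have hN' : N' = ⊤ := (eq_bot_or_eq_top N').resolve_left fun hb => hN <|
    (LieSubmodule.eq_bot_iff N).2 fun m hm => (LieSubmodule.mem_bot m).1
      (hb ▸ (show m ∈ N' from hm))
  exact eq_top_iff.2 fun m _ => show m ∈ N' from hN' ▸ LieSubmodule.mem_top m

theorem exists_outerTensor (hirr : LieModule.IsIrreducible ℂ (Schrodinger n) M)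
    (hHC : IsHarishChandra n M) (h0 : ∀ (u : Heis n) (m : M), ⁅heis n u, m⁆ = 0) :
    ∃ (V : Type u) (_ : AddCommGroup V) (_ : Module ℂ V)
      (_ : LieRingModule (SO n) V) (_ : LieModule ℂ (SO n) V)
      (L : Type u) (_ : AddCommGroup L) (_ : Module ℂ L)
      (_ : LieRingModule SL2 L) (_ : LieModule ℂ SL2 L),
      FiniteDimensional ℂ V ∧ LieModule.IsIrreducible ℂ (SO n) V ∧
      LieModule.IsIrreducible ℂ SL2 L ∧ IsWeightModule hSL2 L ∧
      Nonempty (M ≃ₗ⁅ℂ, Schrodinger n⁆ OuterTensor n V L) := by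
  let := LieRingModule.compLieHom M (soIncl n)
  have := LieModule.compLieHom M (soIncl n)
  let := LieRingModule.compLieHom M (slIncl n)
  have := LieModule.compLieHom M (slIncl n)
  have hso : ∀ (A : SO n) (m : M), ⁅A, m⁆ = ⁅soIncl n A, m⁆ := fun _ _ => rfl
  have hsl : ∀ (B : SL2) (m : M), ⁅B, m⁆ = ⁅slIncl n B, m⁆ := fun _ _ => rfl
  have hact : ∀ (s : Schrodinger n) (m : M), ⁅s, m⁆ = ⁅s.right.1, m⁆ + ⁅s.right.2, m⁆ :=
    lie_eq_of_heis_zero h0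
  have hc : ∀ (B : SL2) (A : SO n) (m : M), ⁅B, ⁅A, m⁆⁆ = ⁅A, ⁅B, m⁆⁆ := fun B A m => by
    rw [hso, hsl, hso, hsl, lie_comm_of_eq (soIncl_lie_slIncl A B), zero_lie, add_zero]
  have hirr' : ∀ N : Submodule ℂ M, (∀ (A : SO n), ∀ m ∈ N, ⁅A, m⁆ ∈ N) →
      (∀ (B : SL2), ∀ m ∈ N, ⁅B, m⁆ ∈ N) → N = ⊥ ∨ N = ⊤ := by
    intro N hA hB
    let N' : LieSubmodule ℂ (Schrodinger n) M :=
      { N with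
        lie_mem := fun {s m} hm => by
          rw [hact]
          exact N.add_mem (hB _ _ hm) (hA _ _ hm) }
    exact (eq_bot_or_eq_top N').imp (congrArg LieSubmodule.toSubmodule)
      (congrArg LieSubmodule.toSubmodule)
  have hne : ∃ μ, wtSpace (hElt n) M μ ≠ ⊥ := by
    by_contra! hb
    have := LieModule.nontrivial_of_isIrreducible ℂ (Schrodinger n) M
    have ht := hHC.1.submodule_iSup_eq_top
    simp only [hb, iSup_bot] at ht
    exact bot_ne_top ht
  obtain ⟨μ, hμ⟩ := hne
  let W : LieSubmodule ℂ (SO n) M :=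
    { wtSpace (hElt n) M μ with
      lie_mem := fun {A m} hm => by
        have hm : ⁅hSL2, m⁆ = μ • m := (mem_wtSpace _ _).1 hm
        refine (mem_wtSpace _ _).2 (show ⁅hSL2, ⁅A, m⁆⁆ = _ from ?_)
        rw [hc, hm, lie_smul] }
  have hWfin : FiniteDimensional ℂ W := hHC.2 μ
  obtain ⟨V, hVW, hVfin, hV⟩ := exists_irreducible_of_finiteDimensional W fun hb =>
    hμ (congrArg LieSubmodule.toSubmodule hb)
  have hVnt := LieModule.nontrivial_of_isIrreducible ℂ (SO n) V
  have hφ₀ : V.incl ≠ 0 := fun h => by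
    obtain ⟨v, hv⟩ := exists_ne (0 : V)
    exact hv (Subtype.ext (LieModuleHom.congr_fun h v))
  let := homLieRingModule (V := V) hc
  have := homLieModule (V := V) hc
  have hL : LieModule.IsIrreducible ℂ SL2 (V →ₗ⁅ℂ,SO n⁆ M) := hom_irreducible hc hirr' hV hφ₀
  refine ⟨V, inferInstance, inferInstance, inferInstance, inferInstance, V →ₗ⁅ℂ,SO n⁆ M,
    inferInstance, inferInstance, inferInstance, inferInstance, hVfin, hV, hL,
    isWeightModule_of_irreducible hL (μ := μ) (φ := V.incl) ?_ hφ₀, ⟨LieModuleEquiv.symm ?_⟩⟩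
  -- V lies in a single weight space, so its inclusion is a weight vector of weight μ in
  -- Hom_{so_n}(V, M).
  · rw [mem_wtSpace]
    exact LieModuleHom.ext fun v => (mem_wtSpace _ _).1 (hVW v.2)
  · let e : V ⊗[ℂ] (V →ₗ⁅ℂ,SO n⁆ M) ≃ₗ[ℂ] M := LinearEquiv.ofBijective (evalMap (SO n) V M)
      ⟨evalMap_injective hV, evalMap_surjective hc hirr' hφ₀⟩
    have he : ∀ (s : Schrodinger n) (t : V ⊗[ℂ] (V →ₗ⁅ℂ,SO n⁆ M)),
        evalMap (SO n) V M (OuterTensor.op s t) = ⁅s, evalMap (SO n) V M t⁆ := by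
      intro s t
      induction t with
      | zero => simp
      | add x y hx hy => simp only [map_add, hx, hy, lie_add]
      | tmul v φ =>
        have h1 : OuterTensor.op s (v ⊗ₜ[ℂ] φ) =
            ⁅s.right.2, v⁆ ⊗ₜ[ℂ] φ + v ⊗ₜ[ℂ] ⁅s.right.1, φ⁆ := rfl
        rw [h1, map_add, evalMap_tmul, evalMap_tmul, evalMap_tmul, hact, LieModuleHom.map_lie,
          add_comm]
        rfl
    exact { e with
      map_lie' := fun {s t} => he s t }

end Final

end Schr

end

theorem theoremp14 (n : ℕ) (hn : 0 < n)
    (M : Type u) [AddCommGroup M] [Module ℂ M]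
    [LieRingModule (Schr.Schrodinger n) M] [LieModule ℂ (Schr.Schrodinger n) M]
    (hirr : LieModule.IsIrreducible ℂ (Schr.Schrodinger n) M)
    (hHC : Schr.IsHarishChandra n M)
    (hz : ∀ m : M, ⁅Schr.zElt n, m⁆ = 0) :
    (∀ (u : Schr.Heis n) (m : M), ⁅Schr.heis n u, m⁆ = 0) ∧
    LieModule.IsIrreducible ℂ (Schr.levi n).range M ∧
    ∃ (V : Type u) (_ : AddCommGroup V) (_ : Module ℂ V)
      (_ : LieRingModule (Schr.SO n) V) (_ : LieModule ℂ (Schr.SO n) V)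
      (L : Type u) (_ : AddCommGroup L) (_ : Module ℂ L)
      (_ : LieRingModule Schr.SL2 L) (_ : LieModule ℂ Schr.SL2 L),
      FiniteDimensional ℂ V ∧ LieModule.IsIrreducible ℂ (Schr.SO n) V ∧
      LieModule.IsIrreducible ℂ Schr.SL2 L ∧ Schr.IsWeightModule Schr.hSL2 L ∧
      Nonempty (M ≃ₗ⁅ℂ, Schr.Schrodinger n⁆ Schr.OuterTensor n V L) :=
  have h0 := Schr.heis_acts_by_zero hirr hHC hz
  ⟨h0, Schr.levi_irreducible hirr h0, Schr.exists_outerTensor hirr hHC h0⟩
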